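/- **Asymptotic normality of DRM-based estimators.** *Model.* Let $p\ge 0$, $0\le s<q$, $n_q\ge1$, and let $\Theta\subseteq\mathbb R^d$ parametrize a generalized linear latent variable model for $p$ binary items with $q$ latent variables: to $\theta\in\Theta$ correspond intercepts $\alpha_0\in\mathbb R^p$, loadings $\alpha\in\mathbb R^{q\times p}$ and a positive definite matrix $\Psi\in\mathbb R^{q\times q}$, whose entries are twice continuously differentiable functions of $\theta$ on the interior of $\Theta$ (for instance, $\theta$ lists the free entries of $\alpha_0,\alpha,\Psi$). For $y\in\{0,1\}^p$ and $b\in\mathbb R^q$ put $\eta=\alpha_0+\alpha^Tb$, $$g(y\mid b)=\exp\{y^T\eta-\mathbf 1^T\log[1+\exp(\eta)]\},\qquad h(b)=(2\pi)^{-q/2}|\Psi|^{-1/2}e^{-\frac12 b^T\Psi^{-1}b},\qquad L(b)=\log g(y\mid b)+\log h(b).$$ Let $\hat b=\arg\max_b L(b)$, $\hat\Sigma=(-L''(\hat b))^{-1}$, and let $\hat C$ be the Cholesky factor, $\hat\Sigma=\hat C\hat C^T$. *DRM approximation.* Let $x_1,\dots,x_{n_q}$ and $w_1,\dots,w_{n_q}$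 be the Gauss–Hermite nodes and weights (for the weight function $e^{-x^2}$), and $w_t^*=w_te^{x_t^2}$. The DRM approximation of the marginal density $\int g(y\mid b)h(b)\,db$ is $$\tilde f(y;\theta)=(2\pi)^{q/2}|\hat\Sigma|^{1/2}e^{L(\hat b)}\Big[(-1)^s\tbinom{q-1}{s}+\sum_{i=1}^s(-1)^{s-i}\tbinom{q-i-1}{s-i}\sum_{k_1<\dots<k_i}\ \sum_{t_1,\dots,t_i=1}^{n_q}e^{-L(\hat b)}\pi^{-i/2}\,g(y\mid b_{t})\,h(b_{t})\,w^*_{t_1}\cdots w^*_{t_i}\Big],$$ where $b_{t}=\sqrt2\,\hat C x_{t}+\hat b$ and $x_{t}\in\mathbb R^q$ has the entries $x_{t_1},\dots,x_{t_i}$ at the positions $k_1,\dots,k_i$ and $0$ elsewhere. Assume $\tilde f(y;\theta)>0$ for all $y\in\{0,1\}^p$ and $\theta\in\Theta$, and write $\tilde\ell(\theta;y)=\log\tilde f(y;\theta)$. *Estimator.* Let $Y_1,Y_2,\dots$ be independent and identically distributed with values in $\{0,1\}^p$ (their common law may, but need not, belong to the model). Let $\hat\theta=\hat\theta_n$ be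 random vectors that, with probability tending to $1$ as $n\to\infty$, lie in $\Theta$ and maximize the DRM-approximated log-likelihood $\sum_{l=1}^n\tilde\ell(\theta;Y_l)$ over $\theta\in\Theta$. Let $\theta_0\in\Theta$ be the parameter value targeted by this M-estimator, that is, the well-separated maximizer of the expected criterion: for every $\varepsilon>0$ there is $\delta>0$ such that $E[\tilde\ell(\theta;Y_1)]\le E[\tilde\ell(\theta_0;Y_1)]-\delta$ for all $\theta\in\Theta$ with $\|\theta-\theta_0\|\ge\varepsilon$. *Claim.* If $\theta_0$ is an interior point of $\Theta$ and $$H(\theta_0)=-E\left[\frac{\partial^2\tilde\ell(\theta_0;Y_1)}{\partial\theta\,\partial\theta^T}\right]$$ is nonsingular, then, as $n\to\infty$ with $p$, $q$, $s$, $n_q$ fixed, $$\sqrt n(\hat\theta-\theta_0)\xrightarrow{D}\mathrm{MVN}\big(0,\;H(\theta_0)^{-1}U(\theta_0)[H(\theta_0)^{-1}]^T\big),\qquad U(\theta_0)=E\left[\frac{\partial\tilde\ell(\theta_0;Y_1)}{\partial\theta}\frac{\partial\tilde\ell(\theta_0;Y_1)}{\partial\theta}^{T}\right].$$ -/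

import Mathlib

open MeasureTheory ProbabilityTheory Filter Topology

noncomputable section

namespace DRM

/-- First partial derivative of `F` at `x` in the direction of the `i`-th basis vector. -/
def partialDeriv {E ι : Type*} [NormedAddCommGroup E] [NormedSpace ℝ E]
    (e : ι → E) (F : E → ℝ) (x : E) (i : ι) : ℝ :=
  fderiv ℝ F x (e i)

/-- The matrix of second partial derivatives of `F` at `x` along the basis vectors `e`. -/
def hessian {E ι : Type*} [NormedAddCommGroup E] [NormedSpace ℝ E]
    (e : ι → E) (F : E → ℝ) (x : E) : Matrix ι ι ℝ :=
  Matrix.of fun i j => fderiv ℝ (fun z => fderiv ℝ F z (e j)) x (e i)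

/-- The standard basis of `ℝ^d`. -/
def stdBasis (d : ℕ) (i : Fin d) : EuclideanSpace ℝ (Fin d) := EuclideanSpace.single i 1

/-! ### Gauss–Hermite quadrature for the weight `exp (-x^2)` -/

/-- The physicists' Hermite polynomial `H_m(x) = 2^{m/2} He_m(√2 x)`, where `He_m` (Mathlib's
`Polynomial.hermite`) is the probabilists' one. -/
def hermitePoly (m : ℕ) : Polynomial ℝ :=
  Polynomial.C (√2 ^ m) *
    ((Polynomial.hermite m).map (Int.castRingHom ℝ)).comp (Polynomial.C √2 * Polynomial.X)

/-- The Gauss–Hermite nodes: the (real, simple) roots of the `m`-th Hermite polynomial. -/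
def ghNodes (m : ℕ) : Finset ℝ := (hermitePoly m).roots.toFinset

/-- The Gauss–Hermite weight of the node `x`: the integral of the Lagrange basis polynomial of
`x` against `exp (-u^2)`. -/
def ghWeight (m : ℕ) (x : ℝ) : ℝ :=
  ∫ u : ℝ, (Lagrange.basis (ghNodes m) id x).eval u * Real.exp (-u ^ 2)

/-- The modified weight `w* = w exp (x^2)`. -/
def ghWeightStar (m : ℕ) (x : ℝ) : ℝ := ghWeight m x * Real.exp (x ^ 2)

/-- The lower triangular matrix `C` with positive diagonal such that `C Cᵀ = S`
(it exists and is unique for positive definite `S`). -/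
def cholesky {q : ℕ} (S : Matrix (Fin q) (Fin q) ℝ) : Matrix (Fin q) (Fin q) ℝ :=
  Classical.epsilon fun C : Matrix (Fin q) (Fin q) ℝ =>
    (∀ i j, i < j → C i j = 0) ∧ (∀ i, 0 < C i i) ∧ C * C.transpose = S

/-! ### The latent variable model for binary items -/

/-- A generalized linear latent variable model with `p` binary items, `q` latent variables and a
`d`-dimensional vector of free parameters: intercepts `α₀`, loadings `α` and the covariance matrix
`Ψ` of the latent variables, as functions of the parameter vector. -/
structure GLLVM (d p q : ℕ) where
  intercept : EuclideanSpace ℝ (Fin d) → Fin p → ℝ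
  loading : EuclideanSpace ℝ (Fin d) → Matrix (Fin q) (Fin p) ℝ
  latentCov : EuclideanSpace ℝ (Fin d) → Matrix (Fin q) (Fin q) ℝ

namespace GLLVM

variable {d p q : ℕ} (M : GLLVM d p q)

/-- The systematic component `η = α₀ + αᵀ b`. -/
def eta (θ : EuclideanSpace ℝ (Fin d)) (b : Fin q → ℝ) (j : Fin p) : ℝ :=
  M.intercept θ j + (M.loading θ).transpose.mulVec b j

/-- `g(y | b) = exp (yᵀ η - 1ᵀ log (1 + exp η))`. -/
def measurementDensity (θ : EuclideanSpace ℝ (Fin d)) (y : Fin p → Bool) (b : Fin q → ℝ) : ℝ :=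
  Real.exp (∑ j, ((if y j then M.eta θ b j else 0) - Real.log (1 + Real.exp (M.eta θ b j))))

/-- `h(b)`, the density of the normal distribution with mean `0` and covariance matrix `Ψ`. -/
def latentDensity (θ : EuclideanSpace ℝ (Fin d)) (b : Fin q → ℝ) : ℝ :=
  (√((2 * Real.pi) ^ q * (M.latentCov θ).det))⁻¹ *
    Real.exp (-(1 / 2) * (b ⬝ᵥ (M.latentCov θ)⁻¹.mulVec b))

/-- `L(b) = log g(y | b) + log h(b)`. -/
def logJoint (θ : EuclideanSpace ℝ (Fin d)) (y : Fin p → Bool) (b : Fin q → ℝ) : ℝ :=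
  Real.log (M.measurementDensity θ y b) + Real.log (M.latentDensity θ b)

/-- The mode `b̂ = argmax_b L(b)` (`L` has exactly one maximizer when `Ψ` is positive definite). -/
def mode (θ : EuclideanSpace ℝ (Fin d)) (y : Fin p → Bool) : Fin q → ℝ :=
  Classical.epsilon fun b => ∀ b', M.logJoint θ y b' ≤ M.logJoint θ y b

/-- `Σ̂ = (-L''(b̂))⁻¹`. -/
def modeCov (θ : EuclideanSpace ℝ (Fin d)) (y : Fin p → Bool) : Matrix (Fin q) (Fin q) ℝ :=
  (-hessian (fun k : Fin q => (Pi.single k 1 : Fin q → ℝ)) (M.logJoint θ y) (M.mode θ y))⁻¹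

/-- The adaptive node `√2 Ĉ x + b̂`, where `Ĉ` is the Cholesky factor of `Σ̂` and `x` has the
coordinates `t k` for `k ∈ I` and `0` for the other `k`. -/
def adaptedNode (θ : EuclideanSpace ℝ (Fin d)) (y : Fin p → Bool) (I : Finset (Fin q))
    (t : I → ℝ) : Fin q → ℝ :=
  √2 • (cholesky (M.modeCov θ y)).mulVec (fun k => if hk : k ∈ I then t ⟨k, hk⟩ else 0)
    + M.mode θ y

/-- The DRM approximation `f̃(y; θ)` of the marginal density of a response pattern `y`, based on
Cut-HDMR terms of at most `s` variables and `m` Gauss–Hermite nodes per variable. -/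
def approxDensity (s m : ℕ) (θ : EuclideanSpace ℝ (Fin d)) (y : Fin p → Bool) : ℝ :=
  (2 * Real.pi) ^ ((q : ℝ) / 2) * √(M.modeCov θ y).det *
    Real.exp (M.logJoint θ y (M.mode θ y)) *
    ((-1) ^ s * ((q - 1).choose s : ℝ) +
      ∑ i ∈ Finset.Icc 1 s, (-1) ^ (s - i) * ((q - i - 1).choose (s - i) : ℝ) *
        ∑ I ∈ Finset.powersetCard i (Finset.univ : Finset (Fin q)),
          ∑ t ∈ Fintype.piFinset (fun _ : I => ghNodes m),
            Real.exp (-M.logJoint θ y (M.mode θ y)) * Real.pi ^ (-(i : ℝ) / 2) *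
              M.measurementDensity θ y (M.adaptedNode θ y I t) *
              M.latentDensity θ (M.adaptedNode θ y I t) *
              ∏ k : I, ghWeightStar m (t k))

/-- The contribution `log f̃(y; θ)` of one response pattern to the DRM log-likelihood. -/
def approxLogLik (s m : ℕ) (y : Fin p → Bool) (θ : EuclideanSpace ℝ (Fin d)) : ℝ :=
  Real.log (M.approxDensity s m θ y)

/-- The DRM-approximated log-likelihood `∑_{l < n} log f̃(y_l; θ)` of a sample of size `n`. -/
def sampleLogLik (s m : ℕ) (y : ℕ → Fin p → Bool) (n : ℕ)
    (θ : EuclideanSpace ℝ (Fin d)) : ℝ :=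
  ∑ l ∈ Finset.range n, M.approxLogLik s m (y l) θ

variable {Ω : Type*} [MeasurableSpace Ω]

/-- The population criterion `E[log f̃(Y; θ)]`. -/
def expectedLogLik (s m : ℕ) (μ : Measure Ω) (Y : Ω → Fin p → Bool)
    (θ : EuclideanSpace ℝ (Fin d)) : ℝ :=
  ∫ ω, M.approxLogLik s m (Y ω) θ ∂μ

/-- `H(θ) = -E[∂² log f̃(Y; θ) / ∂θ ∂θᵀ]`. -/
def matH (s m : ℕ) (μ : Measure Ω) (Y : Ω → Fin p → Bool)
    (θ : EuclideanSpace ℝ (Fin d)) : Matrix (Fin d) (Fin d) ℝ :=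
  Matrix.of fun i j => -∫ ω, hessian (stdBasis d) (M.approxLogLik s m (Y ω)) θ i j ∂μ

/-- `U(θ) = E[(∂ log f̃(Y; θ) / ∂θ) (∂ log f̃(Y; θ) / ∂θ)ᵀ]`. -/
def matU (s m : ℕ) (μ : Measure Ω) (Y : Ω → Fin p → Bool)
    (θ : EuclideanSpace ℝ (Fin d)) : Matrix (Fin d) (Fin d) ℝ :=
  Matrix.of fun i j => ∫ ω, partialDeriv (stdBasis d) (M.approxLogLik s m (Y ω)) θ i *
    partialDeriv (stdBasis d) (M.approxLogLik s m (Y ω)) θ j ∂μ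

end GLLVM

end DRM

end

/-!
The DRM estimator is an M-estimator based on observations with finitely many possible values, and
its criterion is a finite combination `∑ y, p̂ y * ℓ y θ` of the functions `ℓ y θ = log f̃(y; θ)`,
where `p̂ y` are the relative frequencies of the response patterns. Only two properties of these
functions are needed.

* `ℓ y` is bounded above on `Θ`. Every node contributes `exp (L(b_t) - L(b̂)) ≤ 1` to the bracket of
  `f̃`, and the Laplace factor in front of it is bounded because `|Σ̂| ≤ |Ψ|`
  (`DRM.GLLVM.exists_approxDensity_le`).
* `ℓ y` is twice continuously differentiable at interior points of `Θ`. The mode `b̂` is the unique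
  zero of the gradient of the strictly concave function `L`, and the Cholesky factor is the unique
  solution of polynomial equations, so that both are as smooth as the model by the implicit function
  theorem (`contDiffAt_of_locally_unique_solution`, `contDiffAt_cholesky`,
  `DRM.GLLVM.RegularAt.contDiffAt_mode`, `DRM.GLLVM.RegularAt.contDiffAt_approxDensity`).

For such a criterion asymptotic normality is proved in `tendstoInDistribution_mEstimator`. On the
event that `p̂` is close to the law `w` of the response patterns, whose probability tends to one,
everything is deterministic. Consistency follows by writing `p̂` as a mixture of `w`, with weight
close to one, and some other distribution: the upper bound of `ℓ` keeps the second component from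
compensating the gap that the first one has away from `θ₀` (`exists_pos_forall_sum_mul_neg`), so
that no uniform convergence over `Θ` is needed. Linearizing the score equation at `θ₀` then shows
that `√n (θ̂ - θ₀)` differs from the normalized sum of the influence functions `H⁻¹ ∇ℓ` by a small
multiple of the norm of that sum (`exists_linearization`), and the multivariate central limit
theorem (`tendstoInDistribution_multivariateGaussian`) gives the limit.
-/

/-! ### Central limit theorem, negligible errors and relative frequencies -/

theorem quadForm_eq_integral_sq {d : ℕ} {Ω : Type*} [MeasurableSpace Ω] {P : Measure Ω}
    {Z : Ω → EuclideanSpace ℝ (Fin d)} (hZ : MemLp Z 2 P) {S : Matrix (Fin d) (Fin d) ℝ}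
    (hS : ∀ i j, S i j = ∫ ω, Z ω i * Z ω j ∂P) (t : Fin d → ℝ) :
    t ⬝ᵥ S.mulVec t = ∫ ω, (∑ i, t i * Z ω i) ^ 2 ∂P := by
  have hcoord : ∀ i, MemLp (fun ω => Z ω i) 2 P := fun i =>
    hZ.of_le ((by fun_prop :
      Continuous fun x : EuclideanSpace ℝ (Fin d) => x i).comp_aestronglyMeasurable
      hZ.aestronglyMeasurable) (ae_of_all _ fun ω => PiLp.norm_apply_le _ _)
  have hint : ∀ i j, Integrable (fun ω => Z ω i * Z ω j) P := fun i j =>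
    (hcoord i).integrable_mul (hcoord j)
  have : ∀ ω, (∑ i, t i * Z ω i) ^ 2 = ∑ i, ∑ j, t i * t j * (Z ω i * Z ω j) := fun ω => by
    rw [sq, Finset.sum_mul_sum]
    exact Finset.sum_congr rfl fun i _ => Finset.sum_congr rfl fun j _ => by ring
  simp_rw [this]
  rw [integral_finsetSum _ fun i _ => integrable_finsetSum _ fun j _ => (hint i j).const_mul _]
  simp_rw [integral_finsetSum Finset.univ fun j _ => (hint _ j).const_mul _, integral_const_mul,
    ← hS, dotProduct, Matrix.mulVec, dotProduct, Finset.mul_sum]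
  exact Finset.sum_congr rfl fun i _ => Finset.sum_congr rfl fun j _ => by ring

/-- The matrix of second moments is positive semidefinite: without this, `multivariateGaussian`
would be a point mass. -/
theorem posSemidef_of_secondMoment {d : ℕ} {Ω : Type*} [MeasurableSpace Ω] {P : Measure Ω}
    {Z : Ω → EuclideanSpace ℝ (Fin d)} (hZ : MemLp Z 2 P) {S : Matrix (Fin d) (Fin d) ℝ}
    (hS : ∀ i j, S i j = ∫ ω, Z ω i * Z ω j ∂P) : S.PosSemidef := by
  refine Matrix.PosSemidef.of_dotProduct_mulVec_nonneg ?_ fun t => ?_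
  · ext i j
    simp [hS, mul_comm]
  · rw [star_trivial, quadForm_eq_integral_sq hZ hS]
    positivity

/-- The **multivariate central limit theorem**, reduced to the one-dimensional one by evaluating
characteristic functions along lines. -/
theorem tendstoInDistribution_multivariateGaussian {d : ℕ} {Ω : Type*} [MeasurableSpace Ω]
    {P : Measure Ω} [IsProbabilityMeasure P] {Z : ℕ → Ω → EuclideanSpace ℝ (Fin d)}
    (hindep : iIndepFun Z P) (hident : ∀ n, IdentDistrib (Z n) (Z 0) P P)
    (hZ : MemLp (Z 0) 2 P) (h0 : P[Z 0] = 0) {S : Matrix (Fin d) (Fin d) ℝ}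
    (hS : ∀ i j, S i j = ∫ ω, Z 0 ω i * Z 0 ω j ∂P) :
    TendstoInDistribution (fun (n : ℕ) ω => (√(n : ℝ))⁻¹ • ∑ k ∈ Finset.range n, Z k ω) atTop
      (id : EuclideanSpace ℝ (Fin d) → EuclideanSpace ℝ (Fin d)) (fun _ => P)
      (multivariateGaussian 0 S) := by
  have hmeas : ∀ n, AEMeasurable (Z n) P := fun n => (hident n).aemeasurable_fst
  have hVmeas : ∀ n : ℕ, AEMeasurable (fun ω => (√(n : ℝ))⁻¹ • ∑ k ∈ Finset.range n, Z k ω) P :=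
    fun n => by fun_prop
  refine ⟨hVmeas, aemeasurable_id, ?_⟩
  refine ProbabilityMeasure.tendsto_iff_tendsto_charFun.2 fun t => ?_
  have hinner : Measurable fun x : EuclideanSpace ℝ (Fin d) => inner ℝ x t := by fun_prop
  have hXlp : MemLp (fun ω => inner ℝ (Z 0 ω) t) 2 P := hZ.inner_const t
  have hmean : ∫ ω, inner ℝ (Z 0 ω) t ∂P = 0 := by
    have := integral_inner (𝕜 := ℝ) (hZ.integrable (by norm_num)) t
    simp_rw [real_inner_comm t] at this ⊢
    rw [this, h0, inner_zero_right]
  have hvar : Var[fun ω => inner ℝ (Z 0 ω) t; P] = t.ofLp ⬝ᵥ S.mulVec t.ofLp := by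
    rw [variance_of_integral_eq_zero hXlp.aestronglyMeasurable.aemeasurable hmean,
      quadForm_eq_integral_sq hZ hS]
    simp [PiLp.inner_apply]
  -- the centering term `n * E[⟪Z, t⟫]` of the one-dimensional theorem vanishes by `hmean`
  have hclt := tendstoInDistribution_inv_sqrt_mul_sum_sub (P := P)
    (X := fun k ω => inner ℝ (Z k ω) t) (Y := id)
    (P' := gaussianReal 0 Var[fun ω => inner ℝ (Z 0 ω) t; P].toNNReal)
    HasLaw.id hXlp (hindep.comp (fun _ x => inner ℝ x t) fun _ => hinner)
    (fun n => (hident n).comp hinner)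
  have hchar := ProbabilityMeasure.tendsto_iff_tendsto_charFun.1 hclt.tendsto 1
  refine Tendsto.congr (fun n => ?_) (hchar.trans (le_of_eq ?_))
  · simp only [ProbabilityMeasure.coe_mk]
    rw [charFun_apply, charFun_apply, integral_map (hVmeas n) (by fun_prop),
      integral_map (hclt.forall_aemeasurable n) (by fun_prop)]
    refine integral_congr_ae (ae_of_all _ fun ω => ?_)
    simp [hmean, inner_smul_left, sum_inner]
  · simp only [ProbabilityMeasure.coe_mk, Measure.map_id]
    rw [charFun_gaussianReal, charFun_multivariateGaussian (posSemidef_of_secondMoment hZ hS)]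
    have h1 : ((Var[fun ω => inner ℝ (Z 0 ω) t; P].toNNReal : ℝ)) = t.ofLp ⬝ᵥ S.mulVec t.ofLp := by
      rw [Real.coe_toNNReal _ (variance_nonneg _ _), hvar]
    simp [h1]

/-- A relative version of Slutsky's lemma: since a sequence that converges in distribution is
bounded in probability, an error that is negligible relative to its norm does not affect the
limit. -/
theorem tendstoInDistribution_of_relative_error {E Ω Ω' : Type*} [NormedAddCommGroup E]
    [MeasurableSpace E] [BorelSpace E] [SecondCountableTopology E]
    [MeasurableSpace Ω] [MeasurableSpace Ω'] {P : Measure Ω} [IsProbabilityMeasure P]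
    {P' : Measure Ω'} [IsProbabilityMeasure P'] {V W : ℕ → Ω → E} {Z : Ω' → E}
    (hV : TendstoInDistribution V atTop Z (fun _ => P) P') (hW : ∀ n, AEMeasurable (W n) P)
    (hrel : ∀ c > 0, Tendsto (fun n => P {ω | ¬ ‖W n ω - V n ω‖ ≤ c * ‖V n ω‖}) atTop (𝓝 0)) :
    TendstoInDistribution W atTop Z (fun _ => P) P' := by
  refine tendstoInDistribution_of_tendstoInMeasure_sub W Z hV ?_ hW
  rw [tendstoInMeasure_iff_norm]
  intro ε hε
  simp only [Pi.sub_apply, Pi.zero_apply, sub_zero]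
  -- the tail of the limit law beyond radius `R`
  have htail : Tendsto (fun R : ℕ => (P'.map Z) {x | (R : ℝ) ≤ ‖x‖}) atTop (𝓝 0) := by
    have := hV.aemeasurable_limit
    have : IsProbabilityMeasure (P'.map Z) := Measure.isProbabilityMeasure_map this
    have h := tendsto_measure_iInter_atTop (μ := P'.map Z) (s := fun R : ℕ => {x | (R : ℝ) ≤ ‖x‖})
      (fun R => (measurableSet_le measurable_const measurable_norm).nullMeasurableSet)
      (fun a b hab x (hx : (b : ℝ) ≤ ‖x‖) => le_trans (Nat.cast_le.2 hab) hx)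
      ⟨0, measure_ne_top _ _⟩
    have hempty : ⋂ R : ℕ, {x : E | (R : ℝ) ≤ ‖x‖} = ∅ := by
      refine Set.eq_empty_of_forall_notMem fun x hx => ?_
      obtain ⟨R, hR⟩ := exists_nat_gt ‖x‖
      exact absurd (Set.mem_iInter.1 hx R) (not_le.2 hR)
    rwa [hempty, measure_empty] at h
  rw [ENNReal.tendsto_nhds_zero]
  intro δ hδ
  have hδ2 : 0 < δ / 2 := ENNReal.half_pos hδ.ne'
  obtain ⟨R, hRtail, hR0⟩ :=
    ((htail.eventually (gt_mem_nhds hδ2)).and (eventually_gt_atTop 0)).exists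
  have hRpos : (0 : ℝ) < R := by exact_mod_cast hR0
  have hlim := ProbabilityMeasure.limsup_measure_closed_le_of_tendsto hV.tendsto
    (F := {x | (R : ℝ) ≤ ‖x‖}) (isClosed_le continuous_const continuous_norm)
  have hev1 := eventually_lt_of_limsup_lt (hlim.trans_lt hRtail)
  have hev2 := (hrel (ε / (2 * R)) (by positivity)).eventually (gt_mem_nhds hδ2)
  filter_upwards [hev1, hev2] with n h1 h2
  rw [ProbabilityMeasure.coe_mk, Measure.map_apply_of_aemeasurable (hV.forall_aemeasurable n)
    (measurableSet_le measurable_const measurable_norm)] at h1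
  refine le_trans (measure_mono ?_) ((measure_union_le _ _).trans
    ((add_le_add h1.le h2.le).trans_eq (ENNReal.add_halves δ)))
  intro ω hω
  by_contra hcon
  simp only [Set.mem_union, Set.mem_preimage, Set.mem_ofPred_eq, not_or, not_le] at hcon hω
  have : ε / (2 * R) * ‖V n ω‖ ≤ ε / (2 * R) * R := by gcongr; exact hcon.1.le
  have h3 : ε / (2 * R) * R = ε / 2 := by field_simp
  linarith [hcon.2]

/-- The relative frequency of the outcome `y` among the first `n` observations. -/
noncomputable def empFreq {𝒴 : Type*} [DecidableEq 𝒴] (z : ℕ → 𝒴) (n : ℕ) (y : 𝒴) : ℝ :=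
  (n : ℝ)⁻¹ * ∑ l ∈ Finset.range n, if z l = y then 1 else 0

section empFreq

variable {𝒴 : Type*} [DecidableEq 𝒴]

theorem empFreq_nonneg (z : ℕ → 𝒴) (n : ℕ) (y : 𝒴) : 0 ≤ empFreq z n y :=
  mul_nonneg (by positivity) (Finset.sum_nonneg fun _ _ => by split_ifs <;> norm_num)

variable [Fintype 𝒴]

theorem sum_empFreq_smul {F : Type*} [AddCommGroup F] [Module ℝ F] (z : ℕ → 𝒴) (n : ℕ)
    (f : 𝒴 → F) :
    ∑ y, empFreq z n y • f y = (n : ℝ)⁻¹ • ∑ l ∈ Finset.range n, f (z l) := by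
  simp_rw [empFreq, mul_smul, ← Finset.smul_sum, Finset.sum_smul]
  rw [Finset.sum_comm]
  simp

theorem sum_empFreq (z : ℕ → 𝒴) {n : ℕ} (hn : n ≠ 0) : ∑ y, empFreq z n y = 1 := by
  have := sum_empFreq_smul z n (fun _ => (1 : ℝ))
  simp only [smul_eq_mul, mul_one, Finset.sum_const, Finset.card_range, nsmul_eq_mul] at this
  rw [this, inv_mul_cancel₀ (by exact_mod_cast hn)]

variable [MeasurableSpace 𝒴] [MeasurableSingletonClass 𝒴]

/-- The weak law of large numbers for the relative frequencies of finitely many outcomes. -/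
theorem tendsto_measure_empFreq {Ω : Type*} [MeasurableSpace Ω] {P : Measure Ω}
    [IsProbabilityMeasure P] {Y : ℕ → Ω → 𝒴} (hindep : iIndepFun Y P)
    (hident : ∀ l, IdentDistrib (Y l) (Y 0) P P) {η : ℝ} (hη : 0 < η) :
    Tendsto (fun n => P {ω | ¬ ∀ y, |empFreq (fun l => Y l ω) n y - (P.map (Y 0)).real {y}| ≤ η})
      atTop (𝓝 0) := by
  have key : ∀ y, Tendsto
      (fun n => P {ω | η ≤ ‖empFreq (fun l => Y l ω) n y - (P.map (Y 0)).real {y}‖})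
      atTop (𝓝 0) := by
    intro y
    let u : 𝒴 → ℝ := fun x => if x = y then 1 else 0
    have hu : Measurable u := measurable_of_finite u
    have hYm : ∀ l, AEMeasurable (Y l) P := fun l => (hident l).aemeasurable_fst
    have hum : ∀ l, AEMeasurable (fun ω => u (Y l ω)) P := fun l => hu.comp_aemeasurable (hYm l)
    have hint : Integrable (fun ω => u (Y 0 ω)) P :=
      .of_bound (hum 0).aestronglyMeasurable 1 (ae_of_all _ fun ω => by
        simp only [u]; split_ifs <;> norm_num)
    have hexp : ∫ ω, u (Y 0 ω) ∂P = (P.map (Y 0)).real {y} := by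
      rw [← integral_map (hYm 0) hu.aestronglyMeasurable]
      have : u = Set.indicator {y} 1 := by
        ext x; simp [u, Set.indicator_apply]
      rw [this, integral_indicator_one (measurableSet_singleton y)]
    have hslln := strong_law_ae_real (fun l ω => u (Y l ω)) hint
      (fun i j hij => (hindep.indepFun hij).comp hu hu) (fun l => (hident l).comp hu)
    have hfreq : ∀ n ω, empFreq (fun l => Y l ω) n y = (∑ l ∈ Finset.range n, u (Y l ω)) / n :=
      fun n ω => by rw [empFreq, div_eq_inv_mul]
    simp_rw [hfreq, ← hexp]
    refine tendstoInMeasure_iff_norm.1 (tendstoInMeasure_of_tendsto_ae (fun n => ?_) hslln) η hη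
    exact ((Finset.aemeasurable_fun_sum _ fun l _ => hum l).div_const _).aestronglyMeasurable
  have hsum := tendsto_finsetSum Finset.univ fun y _ => key y
  rw [Finset.sum_const_zero] at hsum
  refine tendsto_of_tendsto_of_tendsto_of_le_of_le tendsto_const_nhds hsum
    (fun _ => zero_le) fun n => ?_
  refine (measure_mono fun ω hω => ?_).trans (measure_iUnion_fintype_le _ _)
  simp only [Set.mem_ofPred_eq, not_forall, not_le] at hω
  obtain ⟨y, hy⟩ := hω
  exact Set.mem_iUnion.2 ⟨y, hy.le⟩

end empFreq

/-! ### M-estimation with finitely many outcomes -/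

/-- The gradient of `F` at `x`, the column vector of its partial derivatives. -/
noncomputable def gradVec {d : ℕ} (F : EuclideanSpace ℝ (Fin d) → ℝ)
    (x : EuclideanSpace ℝ (Fin d)) : EuclideanSpace ℝ (Fin d) :=
  WithLp.toLp 2 (DRM.partialDeriv (DRM.stdBasis d) F x)

theorem EuclideanSpace.eq_sum_stdBasis {d : ℕ} (v : EuclideanSpace ℝ (Fin d)) :
    v = ∑ i, v i • DRM.stdBasis d i := by
  ext j
  simp [DRM.stdBasis, Pi.single_apply]

/-- The derivative of the gradient is the Hessian matrix, acting from the left. Since the derivative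
of the `i`-th partial derivative is the `i`-th column of `DRM.hessian`, this needs the symmetry of
the second derivative. -/
theorem hasFDerivAt_gradVec {d : ℕ} {F : EuclideanSpace ℝ (Fin d) → ℝ}
    {x : EuclideanSpace ℝ (Fin d)} (hF : ContDiffAt ℝ 2 F x) :
    HasFDerivAt (gradVec F)
      (Matrix.toEuclideanCLM (𝕜 := ℝ) (DRM.hessian (DRM.stdBasis d) F x)) x := by
  have hD : DifferentiableAt ℝ (fderiv ℝ F) x :=
    (hF.fderiv_right (m := 1) (by norm_num)).differentiableAt (by norm_num)
  have hsymm : IsSymmSndFDerivAt ℝ F x := hF.isSymmSndFDerivAt (by simp)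
  have hcomp : ∀ v, HasFDerivAt (fun z => fderiv ℝ F z v)
      ((ContinuousLinearMap.apply ℝ ℝ v).comp (fderiv ℝ (fderiv ℝ F) x)) x := fun v =>
    (ContinuousLinearMap.apply ℝ ℝ v).hasFDerivAt.comp x hD.hasFDerivAt
  rw [← hasFDerivWithinAt_univ, hasFDerivWithinAt_euclidean]
  intro i
  rw [hasFDerivWithinAt_univ]
  refine HasFDerivAt.congr_fderiv (f := fun z => gradVec F z i) (hcomp (DRM.stdBasis d i)) ?_
  ext v
  simp only [ContinuousLinearMap.comp_apply, ContinuousLinearMap.apply_apply, PiLp.proj_apply,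
    Matrix.ofLp_toEuclideanCLM, Matrix.mulVec, dotProduct, DRM.hessian, Matrix.of_apply,
    (hcomp _).fderiv]
  rw [hsymm v (DRM.stdBasis d i)]
  conv_lhs => rw [EuclideanSpace.eq_sum_stdBasis v]
  simp [mul_comm]

/-- The score equation at a local maximum of a weighted criterion. -/
theorem sum_smul_gradVec_eq_zero {𝒴 : Type*} [Fintype 𝒴] {d : ℕ}
    {ℓ : 𝒴 → EuclideanSpace ℝ (Fin d) → ℝ} {x : EuclideanSpace ℝ (Fin d)}
    (hdiff : ∀ y, DifferentiableAt ℝ (ℓ y) x) (w : 𝒴 → ℝ)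
    (hmax : IsLocalMax (fun z => ∑ y, w y * ℓ y z) x) :
    ∑ y, w y • gradVec (ℓ y) x = 0 := by
  have hder : HasFDerivAt (fun z => ∑ y, w y * ℓ y z) (∑ y, w y • fderiv ℝ (ℓ y) x) x :=
    HasFDerivAt.fun_sum fun y _ => (hdiff y).hasFDerivAt.const_mul (w y)
  have h0 := hmax.hasFDerivAt_eq_zero hder
  ext i
  have := DFunLike.congr_fun h0 (DRM.stdBasis d i)
  simpa [gradVec, DRM.partialDeriv] using this

/-- If the mean of `a` under `w` is at most `-δ` and `a` is bounded above by `K`, then its mean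
under any distribution `v` close to `w` is negative, uniformly in `a`, however negative `a` is. -/
theorem exists_pos_forall_sum_mul_neg {𝒴 : Type*} [Fintype 𝒴] {w : 𝒴 → ℝ} (hw0 : ∀ y, 0 ≤ w y)
    (hw1 : ∑ y, w y = 1) {K δ : ℝ} (hK : 0 ≤ K) (hδ : 0 < δ) :
    ∃ η > 0, ∀ v : 𝒴 → ℝ, ∑ y, v y = 1 → (∀ y, 0 ≤ v y) → (∀ y, |v y - w y| ≤ η) →
      ∀ a : 𝒴 → ℝ, (∀ y, a y ≤ K) → ∑ y, w y * a y ≤ -δ → ∑ y, v y * a y < 0 := by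
  -- Close to `w`, `v` is a mixture of `w`, with weight `1 - τ`, and some distribution, with
  -- weight `τ`; this `τ` makes `τ * K - (1 - τ) * δ = -δ / 2`.
  set τ : ℝ := δ / (2 * (K + δ)) with hτ
  have hτ0 : 0 < τ := by positivity
  have hτK : τ * (K + δ) = δ / 2 := by rw [hτ]; field_simp
  have hτ1 : τ ≤ 1 := by rw [hτ, div_le_one (by positivity)]; linarith
  have hev : ∀ᶠ η in 𝓝[>] (0 : ℝ), ∀ y, 0 < w y → η ≤ τ * w y := by
    refine eventually_all.2 fun y => ?_
    by_cases hy : 0 < w y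
    · filter_upwards [mem_nhdsWithin_of_mem_nhds (Iic_mem_nhds (mul_pos hτ0 hy))] with η hη _
      exact hη
    · exact Eventually.of_forall fun _ h => absurd h hy
  obtain ⟨η, hη, hη0⟩ := (hev.and self_mem_nhdsWithin).exists
  refine ⟨η, hη0, fun v hv1 hv0 hvw a haK ha => ?_⟩
  have hmix : ∀ y, 0 ≤ v y - (1 - τ) * w y := fun y => by
    rcases (hw0 y).eq_or_lt with h | h
    · rw [← h]; simpa using hv0 y
    · have := (abs_le.1 (hvw y)).1
      linarith [hη y h]
  have hsplit : ∑ y, v y * a y =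
      ∑ y, (v y - (1 - τ) * w y) * a y + (1 - τ) * ∑ y, w y * a y := by
    rw [Finset.mul_sum, ← Finset.sum_add_distrib]
    exact Finset.sum_congr rfl fun y _ => by ring
  have hrest : ∑ y, (v y - (1 - τ) * w y) * a y ≤ τ * K := by
    calc _ ≤ ∑ y, (v y - (1 - τ) * w y) * K :=
          Finset.sum_le_sum fun y _ => mul_le_mul_of_nonneg_left (haK y) (hmix y)
      _ = τ * K := by
          rw [← Finset.sum_mul, Finset.sum_sub_distrib, ← Finset.mul_sum, hv1, hw1]; ring
  nlinarith [mul_le_mul_of_nonneg_left ha (sub_nonneg.2 hτ1)]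

/-- Linearization of a score equation `∑ y, v y • G y x = 0` near `x₀` and for weights `v` near `w`,
where `B` is the inverse of the information operator `-∑ y, w y • A y`: the solution satisfies
`x - x₀ ≈ B (∑ y, v y • G y x₀)`, with an arbitrarily small relative error. -/
theorem exists_linearization {𝒴 E : Type*} [Fintype 𝒴] [NormedAddCommGroup E] [NormedSpace ℝ E]
    {G : 𝒴 → E → E} {A : 𝒴 → E →L[ℝ] E} {x₀ : E} (hG : ∀ y, HasFDerivAt (G y) (A y) x₀)
    {w : 𝒴 → ℝ} {B : E →L[ℝ] E} (hB : ∀ x, B (-∑ y, w y • A y x) = x) {c : ℝ} (hc : 0 < c) :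
    ∃ η > 0, ∃ r > 0, ∀ v : 𝒴 → ℝ, ∑ y, v y = 1 → (∀ y, 0 ≤ v y) → (∀ y, |v y - w y| ≤ η) →
      ∀ x, dist x x₀ < r → ∑ y, v y • G y x = 0 →
        ‖(x - x₀) - B (∑ y, v y • G y x₀)‖ ≤ c * ‖B (∑ y, v y • G y x₀)‖ := by
  -- `‖Δ - B s‖ ≤ κ * ‖Δ‖` with `κ ≤ 1 / 2` gives `‖Δ‖ ≤ 2 * ‖B s‖`, and then `2 * κ ≤ c` suffices
  set κ : ℝ := min (1 / 2) (c / 2) with hκ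
  have hκ0 : 0 < κ := by positivity
  set e : ℝ := κ / (2 * (‖B‖ + 1)) with he
  have he0 : 0 < e := by positivity
  set a : ℝ := ∑ y, ‖A y‖ with ha
  have ha0 : 0 ≤ a := Finset.sum_nonneg fun _ _ => norm_nonneg _
  have hlin : ∀ᶠ x in 𝓝 x₀, ∀ y, ‖G y x - G y x₀ - A y (x - x₀)‖ ≤ e * ‖x - x₀‖ :=
    eventually_all.2 fun y => (hG y).isLittleO.def he0
  obtain ⟨r, hr, hball⟩ := Metric.eventually_nhds_iff.1 hlin
  refine ⟨e / (a + 1), by positivity, r, hr, fun v hv1 hv0 hvw x hx hscore => ?_⟩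
  set Δ := x - x₀ with hΔ
  set s := ∑ y, v y • G y x₀ with hs
  have hident : Δ - B s =
      B (∑ y, v y • (G y x - G y x₀ - A y Δ) + ∑ y, (v y - w y) • A y Δ) := by
    nth_rewrite 1 [← hB Δ]
    rw [← map_sub]
    congr 1
    simp_rw [smul_sub, sub_smul, Finset.sum_sub_distrib, hscore, ← hs]
    abel
  have h1 : ‖∑ y, v y • (G y x - G y x₀ - A y Δ)‖ ≤ e * ‖Δ‖ := by
    calc _ ≤ ∑ y, v y * (e * ‖Δ‖) := by
          refine norm_sum_le_of_le _ fun y _ => ?_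
          rw [norm_smul, Real.norm_eq_abs, abs_of_nonneg (hv0 y)]
          exact mul_le_mul_of_nonneg_left (hball hx y) (hv0 y)
      _ = e * ‖Δ‖ := by rw [← Finset.sum_mul, hv1, one_mul]
  have h2 : ‖∑ y, (v y - w y) • A y Δ‖ ≤ e * ‖Δ‖ := by
    calc _ ≤ ∑ y, e / (a + 1) * (‖A y‖ * ‖Δ‖) := by
          refine norm_sum_le_of_le _ fun y _ => ?_
          rw [norm_smul, Real.norm_eq_abs]
          exact mul_le_mul (hvw y) ((A y).le_opNorm _) (norm_nonneg _) (by positivity)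
      _ = e * (a / (a + 1)) * ‖Δ‖ := by
          rw [← Finset.mul_sum, ← Finset.sum_mul, ← ha]; ring
      _ ≤ e * 1 * ‖Δ‖ := by
          gcongr
          rw [div_le_one (by positivity)]; linarith
      _ = e * ‖Δ‖ := by ring
  have h3 : ‖Δ - B s‖ ≤ κ * ‖Δ‖ := by
    rw [hident]
    calc _ ≤ ‖B‖ * (e * ‖Δ‖ + e * ‖Δ‖) :=
          (B.le_opNorm _).trans (by gcongr; exact (norm_add_le _ _).trans (add_le_add h1 h2))
      _ ≤ (‖B‖ + 1) * (e * ‖Δ‖ + e * ‖Δ‖) := by gcongr; linarith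
      _ = κ * ‖Δ‖ := by rw [he]; field_simp; ring
  have h4 : ‖Δ‖ ≤ ‖Δ - B s‖ + ‖B s‖ := by simpa using norm_add_le (Δ - B s) (B s)
  have h5 : κ ≤ 1 / 2 := min_le_left _ _
  have h6 : κ ≤ c / 2 := min_le_right _ _
  have h7 : ‖Δ‖ ≤ 2 * ‖B s‖ := by nlinarith [norm_nonneg Δ]
  nlinarith [norm_nonneg Δ, norm_nonneg (B s)]

theorem integral_comp_eq_sum {𝒴 F Ω : Type*} [Fintype 𝒴] [MeasurableSpace 𝒴]
    [MeasurableSingletonClass 𝒴] [NormedAddCommGroup F] [NormedSpace ℝ F] [CompleteSpace F]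
    [MeasurableSpace Ω] {P : Measure Ω} [IsProbabilityMeasure P] {Y : Ω → 𝒴}
    (hY : AEMeasurable Y P) (f : 𝒴 → F) :
    ∫ ω, f (Y ω) ∂P = ∑ y, (P.map Y).real {y} • f y := by
  have : IsProbabilityMeasure (P.map Y) := Measure.isProbabilityMeasure_map hY
  rw [← integral_map hY (f := f) (StronglyMeasurable.of_discrete).aestronglyMeasurable]
  exact integral_fintype .of_finite

/-- **Asymptotic normality of an M-estimator based on finitely many outcomes.** No uniform
integrability or compactness is needed: it suffices that the criterion `ℓ y` is bounded above
on `Θ` and twice continuously differentiable at the interior point `θ₀`. -/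
theorem tendstoInDistribution_mEstimator {𝒴 Ω : Type*} [Fintype 𝒴] [DecidableEq 𝒴]
    [MeasurableSpace 𝒴] [MeasurableSingletonClass 𝒴] [MeasurableSpace Ω] {P : Measure Ω}
    [IsProbabilityMeasure P] {d : ℕ} {ℓ : 𝒴 → EuclideanSpace ℝ (Fin d) → ℝ}
    {Θ : Set (EuclideanSpace ℝ (Fin d))} {θ₀ : EuclideanSpace ℝ (Fin d)} (hθ₀ : Θ ∈ 𝓝 θ₀)
    (hbdd : ∀ y, BddAbove (ℓ y '' Θ)) (hsmooth : ∀ y, ContDiffAt ℝ 2 (ℓ y) θ₀)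
    {Y : ℕ → Ω → 𝒴} (hindep : iIndepFun Y P) (hident : ∀ l, IdentDistrib (Y l) (Y 0) P P)
    (htarget : ∀ ε > 0, ∃ δ > 0, ∀ θ ∈ Θ, ε ≤ dist θ θ₀ →
      ∫ ω, ℓ (Y 0 ω) θ ∂P + δ ≤ ∫ ω, ℓ (Y 0 ω) θ₀ ∂P)
    {H U : Matrix (Fin d) (Fin d) ℝ}
    (hH : H = Matrix.of fun i j =>
      -∫ ω, DRM.hessian (DRM.stdBasis d) (ℓ (Y 0 ω)) θ₀ i j ∂P)
    (hU : U = Matrix.of fun i j => ∫ ω, DRM.partialDeriv (DRM.stdBasis d) (ℓ (Y 0 ω)) θ₀ i *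
      DRM.partialDeriv (DRM.stdBasis d) (ℓ (Y 0 ω)) θ₀ j ∂P)
    (hdet : IsUnit H.det) {θhat : ℕ → Ω → EuclideanSpace ℝ (Fin d)}
    (hmeas : ∀ n, AEMeasurable (θhat n) P)
    (hmax : Tendsto (fun n => P {ω | ¬ (θhat n ω ∈ Θ ∧ ∀ θ ∈ Θ,
      ∑ l ∈ Finset.range n, ℓ (Y l ω) θ ≤ ∑ l ∈ Finset.range n, ℓ (Y l ω) (θhat n ω))})
      atTop (𝓝 0)) :
    TendstoInDistribution (fun (n : ℕ) ω => √(n : ℝ) • (θhat n ω - θ₀)) atTop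
      (id : EuclideanSpace ℝ (Fin d) → EuclideanSpace ℝ (Fin d)) (fun _ => P)
      (multivariateGaussian 0 (H⁻¹ * U * (H⁻¹).transpose)) := by
  have hYm : ∀ l, AEMeasurable (Y l) P := fun l => (hident l).aemeasurable_fst
  set w : 𝒴 → ℝ := fun y => (P.map (Y 0)).real {y} with hw
  have : IsProbabilityMeasure (P.map (Y 0)) := Measure.isProbabilityMeasure_map (hYm 0)
  have hw0 : ∀ y, 0 ≤ w y := fun y => measureReal_nonneg
  have hw1 : ∑ y, w y = 1 := by
    have := integral_comp_eq_sum (hYm 0) (fun _ => (1 : ℝ))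
    simp only [integral_const, smul_eq_mul, mul_one, probReal_univ] at this
    exact this.symm
  have hθ₀mem : θ₀ ∈ Θ := mem_of_mem_nhds hθ₀
  have hcrit : ∀ θ, ∫ ω, ℓ (Y 0 ω) θ ∂P = ∑ y, w y * ℓ y θ := fun θ =>
    integral_comp_eq_sum (hYm 0) (fun y => ℓ y θ)
  simp_rw [hcrit] at htarget
  -- `A y` is the Hessian of one contribution, `B` the inverse of the information operator
  set A : 𝒴 → EuclideanSpace ℝ (Fin d) →L[ℝ] EuclideanSpace ℝ (Fin d) := fun y =>
    Matrix.toEuclideanCLM (𝕜 := ℝ) (DRM.hessian (DRM.stdBasis d) (ℓ y) θ₀) with hA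
  set B : EuclideanSpace ℝ (Fin d) →L[ℝ] EuclideanSpace ℝ (Fin d) :=
    Matrix.toEuclideanCLM (𝕜 := ℝ) H⁻¹ with hBdef
  have hHsum : H = -∑ y, w y • DRM.hessian (DRM.stdBasis d) (ℓ y) θ₀ := by
    ext i j
    rw [hH, Matrix.of_apply,
      integral_comp_eq_sum (hYm 0) (fun y => DRM.hessian (DRM.stdBasis d) (ℓ y) θ₀ i j)]
    simp [Matrix.sum_apply, hw]
  have hB : ∀ x, B (-∑ y, w y • A y x) = x := fun x => by
    have : -∑ y, w y • A y x = Matrix.toEuclideanCLM (𝕜 := ℝ) H x := by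
      rw [hHsum, map_neg, map_sum]
      simp [hA]
    rw [this, hBdef, ← mul_apply_eq_comp, ← map_mul, Matrix.nonsing_inv_mul _ hdet,
      map_one, one_apply_eq_self]
  have hdiff : ∀ᶠ θ in 𝓝 θ₀, ∀ y, DifferentiableAt ℝ (ℓ y) θ :=
    eventually_all.2 fun y => ((hsmooth y).eventually (by simp)).mono fun θ h =>
      h.differentiableAt (by norm_num)
  -- the expected score vanishes
  have hscore : ∑ y, w y • gradVec (ℓ y) θ₀ = 0 := by
    refine sum_smul_gradVec_eq_zero hdiff.self_of_nhds w ?_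
    filter_upwards [hθ₀] with θ hθ
    rcases eq_or_ne θ θ₀ with rfl | hne
    · exact le_rfl
    · obtain ⟨δ, hδ, h⟩ := htarget (dist θ θ₀) (dist_pos.2 hne)
      linarith [h θ hθ le_rfl]
  -- the central limit theorem for the influence functions
  set Z : ℕ → Ω → EuclideanSpace ℝ (Fin d) := fun l ω => B (gradVec (ℓ (Y l ω)) θ₀) with hZ
  have hψ : Measurable fun y => B (gradVec (ℓ y) θ₀) := measurable_of_finite _
  have hclt := tendstoInDistribution_multivariateGaussian (Z := Z) (P := P)
    (S := H⁻¹ * U * (H⁻¹).transpose) (hindep.comp _ fun _ => hψ)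
    (fun l => (hident l).comp hψ)
    (by
      obtain ⟨C, hC⟩ := (Set.finite_range fun y => ‖B (gradVec (ℓ y) θ₀)‖).bddAbove
      exact .of_bound (hψ.comp_aemeasurable (hYm 0)).aestronglyMeasurable C
        (ae_of_all _ fun ω => hC ⟨Y 0 ω, rfl⟩))
    (by
      rw [integral_comp_eq_sum (hYm 0) (fun y => B (gradVec (ℓ y) θ₀))]
      simp_rw [← map_smul, ← map_sum]
      rw [hscore, map_zero])
    (fun i j => by
      rw [integral_comp_eq_sum (hYm 0)
        (fun y => B (gradVec (ℓ y) θ₀) i * B (gradVec (ℓ y) θ₀) j)]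
      have hUsum : U = ∑ y, w y • Matrix.vecMulVec (DRM.partialDeriv (DRM.stdBasis d) (ℓ y) θ₀)
          (DRM.partialDeriv (DRM.stdBasis d) (ℓ y) θ₀) := by
        ext i j
        rw [hU, Matrix.of_apply, integral_comp_eq_sum (hYm 0)
          (fun y => DRM.partialDeriv (DRM.stdBasis d) (ℓ y) θ₀ i *
            DRM.partialDeriv (DRM.stdBasis d) (ℓ y) θ₀ j)]
        simp [Matrix.sum_apply, Matrix.vecMulVec_apply, hw]
      rw [hUsum, Matrix.mul_sum, Matrix.sum_mul, Matrix.sum_apply]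
      refine Finset.sum_congr rfl fun y _ => ?_
      rw [Matrix.mul_smul, Matrix.smul_mul, Matrix.mul_vecMulVec, Matrix.vecMulVec_mul,
        Matrix.vecMul_transpose]
      simp [hBdef, gradVec, Matrix.vecMulVec_apply, hw])
  refine tendstoInDistribution_of_relative_error hclt
    (fun n => by fun_prop) fun c hc => ?_
  obtain ⟨η₁, hη₁, r, hr, hlin⟩ := exists_linearization (fun y => hasFDerivAt_gradVec (hsmooth y))
    hB hc
  obtain ⟨r', hr', hnear⟩ := Metric.eventually_nhds_iff.1
    ((eventually_mem_nhds_iff.2 hθ₀).and hdiff)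
  obtain ⟨δ, hδ, hsep⟩ := htarget (min r r') (lt_min hr hr')
  choose K hK using hbdd
  obtain ⟨η₂, hη₂, hneg⟩ := exists_pos_forall_sum_mul_neg hw0 hw1
    (K := ∑ y, |K y - ℓ y θ₀|) (Finset.sum_nonneg fun _ _ => abs_nonneg _) hδ
  have hlln := tendsto_measure_empFreq hindep hident (lt_min hη₁ hη₂)
  have hsum := hmax.add hlln
  rw [add_zero] at hsum
  refine tendsto_of_tendsto_of_tendsto_of_le_of_le' tendsto_const_nhds hsum
    (Eventually.of_forall fun _ => zero_le) ?_
  filter_upwards [eventually_ne_atTop 0] with n hn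
  refine (measure_mono fun ω hω => ?_).trans (measure_union_le _ _)
  by_contra hcon
  simp only [Set.mem_union, Set.mem_ofPred_eq, not_or, not_not] at hcon
  obtain ⟨⟨hθmem, hθmax⟩, hfreq⟩ := hcon
  refine hω ?_
  set v := empFreq (fun l => Y l ω) n with hv
  have hv1 : ∑ y, v y = 1 := sum_empFreq _ hn
  have hv0 : ∀ y, 0 ≤ v y := empFreq_nonneg _ _
  have hnpos : (0 : ℝ) < n := by exact_mod_cast Nat.pos_of_ne_zero hn
  have hvsum : ∀ θ, ∑ y, v y * ℓ y θ = (n : ℝ)⁻¹ * ∑ l ∈ Finset.range n, ℓ (Y l ω) θ := fun θ =>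
    sum_empFreq_smul (fun l => Y l ω) n (fun y => ℓ y θ)
  have hvmax : ∀ θ ∈ Θ, ∑ y, v y * ℓ y θ ≤ ∑ y, v y * ℓ y (θhat n ω) := fun θ hθ => by
    rw [hvsum, hvsum]
    exact mul_le_mul_of_nonneg_left (hθmax θ hθ) (by positivity)
  -- consistency
  have hclose : dist (θhat n ω) θ₀ < min r r' := by
    by_contra hfar
    have h1 := hneg v hv1 hv0 (fun y => (hfreq y).trans (min_le_right _ _))
      (fun y => ℓ y (θhat n ω) - ℓ y θ₀) (fun y => ?_) ?_
    · simp_rw [mul_sub, Finset.sum_sub_distrib] at h1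
      linarith [hvmax θ₀ hθ₀mem]
    · calc ℓ y (θhat n ω) - ℓ y θ₀ ≤ K y - ℓ y θ₀ :=
            sub_le_sub_right (hK y ⟨_, hθmem, rfl⟩) _
        _ ≤ |K y - ℓ y θ₀| := le_abs_self _
        _ ≤ ∑ y, |K y - ℓ y θ₀| :=
            Finset.single_le_sum (f := fun y => |K y - ℓ y θ₀|) (fun _ _ => abs_nonneg _)
              (Finset.mem_univ y)
    · simp_rw [mul_sub, Finset.sum_sub_distrib]
      linarith [hsep _ hθmem (not_lt.1 hfar)]
  obtain ⟨hΘ, hd⟩ := hnear (hclose.trans_le (min_le_right _ _))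
  have hest := hlin v hv1 hv0 (fun y => (hfreq y).trans (min_le_left _ _)) _
    (hclose.trans_le (min_le_left _ _))
    (sum_smul_gradVec_eq_zero hd v (by filter_upwards [hΘ] with θ hθ using hvmax θ hθ))
  have hV : (√(n : ℝ))⁻¹ • ∑ k ∈ Finset.range n, Z k ω =
      √(n : ℝ) • B (∑ y, v y • gradVec (ℓ y) θ₀) := by
    rw [hv, sum_empFreq_smul (fun l => Y l ω) n (fun y => gradVec (ℓ y) θ₀), map_smul, map_sum,
      smul_smul]
    congr 1
    have := Real.mul_self_sqrt hnpos.le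
    have h0 : √(n : ℝ) ≠ 0 := (Real.sqrt_pos.2 hnpos).ne'
    field_simp
    rw [sq, this]
  rw [hV, ← smul_sub, norm_smul, norm_smul, mul_left_comm]
  exact mul_le_mul_of_nonneg_left hest (norm_nonneg _)

/-! ### Implicit functions and the Cholesky factor -/

/-- A locally unique solution `f x` of an equation `G x z = G x₀ (f x₀)` depends on the parameter
`x` as smoothly as the equation does, provided that the derivative of the equation in the unknown
is injective. -/
theorem contDiffAt_of_locally_unique_solution {E X : Type*} [NormedAddCommGroup E]
    [NormedSpace ℝ E] [CompleteSpace E] [NormedAddCommGroup X] [NormedSpace ℝ X]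
    [FiniteDimensional ℝ X] {G : E → X → X} {f : E → X} {x₀ : E} {n : WithTop ℕ∞} (hn : n ≠ 0)
    (hG : ContDiffAt ℝ n (fun v : E × X => G v.1 v.2) (x₀, f x₀)) {D : X →L[ℝ] X}
    (hD : HasFDerivAt (G x₀) D (f x₀)) (hinj : Function.Injective D)
    (huniq : ∀ᶠ v : E × X in 𝓝 (x₀, f x₀), G v.1 v.2 = G x₀ (f x₀) → f v.1 = v.2) :
    ContDiffAt ℝ n f x₀ := by
  have : CompleteSpace X := FiniteDimensional.complete ℝ X
  have hpart : fderiv ℝ (fun v : E × X => G v.1 v.2) (x₀, f x₀) ∘L .inr ℝ E X = D := by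
    refine HasFDerivAt.unique (f := G x₀) (x := f x₀) ?_ hD
    exact (hG.differentiableAt hn).hasFDerivAt.comp (f x₀) (hasFDerivAt_prodMk_right x₀ (f x₀))
  have hinv : (fderiv ℝ (fun v : E × X => G v.1 v.2) (x₀, f x₀) ∘L .inr ℝ E X).IsInvertible := by
    rw [hpart]
    refine ⟨(LinearEquiv.ofInjectiveEndo D.toLinearMap hinj).toContinuousLinearEquiv, ?_⟩
    ext x
    rfl
  have hsmooth := hG.contDiffAt_implicitFunction hn hinv
  refine hsmooth.congr_of_eventuallyEq ?_
  have hcont : Tendsto (fun x => (x, hG.implicitFunction hn hinv x)) (𝓝 x₀) (𝓝 (x₀, f x₀)) := by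
    have h := hsmooth.continuousAt.tendsto
    rw [hG.implicitFunction_apply_self hn hinv] at h
    exact tendsto_id.prodMk_nhds h
  filter_upwards [hcont.eventually huniq, hG.eventually_apply_implicitFunction hn hinv]
    with x h1 h2
  exact h1 h2

section matrix

variable {E : Type*} [NormedAddCommGroup E] [NormedSpace ℝ E] {q : ℕ} {n : WithTop ℕ∞} {x₀ : E}

theorem ContDiffAt.matrix_det {S : E → Matrix (Fin q) (Fin q) ℝ}
    (hS : ∀ i j, ContDiffAt ℝ n (fun x => S x i j) x₀) :
    ContDiffAt ℝ n (fun x => (S x).det) x₀ := by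
  simp_rw [Matrix.det_apply']
  exact ContDiffAt.sum fun σ _ => contDiffAt_const.mul (contDiffAt_prod fun i _ => hS _ _)

theorem ContDiffAt.matrix_inv {S : E → Matrix (Fin q) (Fin q) ℝ}
    (hS : ∀ i j, ContDiffAt ℝ n (fun x => S x i j) x₀) (hdet : (S x₀).det ≠ 0) (i j : Fin q) :
    ContDiffAt ℝ n (fun x => (S x)⁻¹ i j) x₀ := by
  simp_rw [Matrix.inv_def, Ring.inverse_eq_inv', Matrix.smul_apply, smul_eq_mul,
    Matrix.adjugate_apply]
  refine ((ContDiffAt.matrix_det hS).inv hdet).mul (ContDiffAt.matrix_det fun k l => ?_)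
  simp_rw [Matrix.updateRow_apply]
  split_ifs
  · exact contDiffAt_const
  · exact hS k l

end matrix

section cholesky

variable {q : ℕ}

/-- `C` is a Cholesky factor of `S`: it is lower triangular with positive diagonal, and
`C Cᵀ = S`. -/
def IsCholesky (S C : Matrix (Fin q) (Fin q) ℝ) : Prop :=
  (∀ i j, i < j → C i j = 0) ∧ (∀ i, 0 < C i i) ∧ C * C.transpose = S

/-- If `C` is lower triangular, then the entry `(i, j)` of `X Cᵀ` involves only the first columns
of `X`, up to the column `j`. -/
theorem mul_transpose_apply_of_lower {X C : Matrix (Fin q) (Fin q) ℝ}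
    (hC : ∀ i j, i < j → C i j = 0) (i j : Fin q) :
    (X * C.transpose) i j = ∑ k ∈ Finset.univ.filter (· < j), X i k * C j k + X i j * C j j := by
  rw [Matrix.mul_apply, ← Finset.sum_filter_add_sum_filter_not Finset.univ (· < j)]
  congr 1
  rw [Finset.sum_eq_single j]
  · simp
  · intro k hk hkj
    have : ¬ k < j := (Finset.mem_filter.1 hk).2
    simp [hC j k (lt_of_le_of_ne (not_lt.1 this) hkj.symm)]
  · intro h
    simp at h

theorem IsCholesky.unique {S C C' : Matrix (Fin q) (Fin q) ℝ} (h : IsCholesky S C)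
    (h' : IsCholesky S C') : C = C' := by
  obtain ⟨hl, hd, hS⟩ := h
  obtain ⟨hl', hd', hS'⟩ := h'
  -- the columns are determined one after the other
  suffices ∀ j i, C i j = C' i j from Matrix.ext fun i j => this j i
  intro j
  induction j using WellFoundedLT.induction with
  | ind j ih =>
    have hsum : ∀ i, ∑ k ∈ Finset.univ.filter (· < j), C i k * C j k =
        ∑ k ∈ Finset.univ.filter (· < j), C' i k * C' j k := fun i =>
      Finset.sum_congr rfl fun k hk => by
        rw [ih k (Finset.mem_filter.1 hk).2, ih k (Finset.mem_filter.1 hk).2]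
    have hcol : ∀ i, C i j * C j j = C' i j * C' j j := fun i => by
      have := congrFun₂ (hS.trans hS'.symm) i j
      rw [mul_transpose_apply_of_lower hl, mul_transpose_apply_of_lower hl', hsum i] at this
      exact add_left_cancel this
    have hdiag : C j j = C' j j := by
      nlinarith [hcol j, hd j, hd' j]
    intro i
    have := hcol i
    rw [hdiag] at this
    exact mul_right_cancel₀ (hd' j).ne' this

/-- The derivative `X ↦ X Cᵀ + C Xᵀ` of `C ↦ C Cᵀ` is injective on lower triangular matrices, one
column after the other. -/
theorem eq_zero_of_mul_transpose_add_eq_zero {C X : Matrix (Fin q) (Fin q) ℝ}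
    (hC : ∀ i j, i < j → C i j = 0) (hdiag : ∀ i, 0 < C i i) (hX : ∀ i j, i < j → X i j = 0)
    (h : ∀ i j, (X * C.transpose) i j + (C * X.transpose) i j = 0) : X = 0 := by
  suffices ∀ j i, X i j = 0 from Matrix.ext fun i j => this j i
  intro j
  induction j using WellFoundedLT.induction with
  | ind j ih =>
    have hcol : ∀ i, X i j * C j j + C i j * X j j = 0 := fun i => by
      have := h i j
      rwa [mul_transpose_apply_of_lower hC, mul_transpose_apply_of_lower hX,
        Finset.sum_eq_zero fun k hk => by rw [ih k (Finset.mem_filter.1 hk).2, zero_mul],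
        Finset.sum_eq_zero fun k hk => by rw [ih k (Finset.mem_filter.1 hk).2, mul_zero],
        zero_add, zero_add] at this
    have hjj : X j j = 0 := by
      have := hcol j
      have h2 : X j j * (2 * C j j) = 0 := by linarith
      exact (mul_eq_zero.1 h2).resolve_right (by have := hdiag j; positivity)
    intro i
    have := hcol i
    rw [hjj, mul_zero, add_zero] at this
    exact (mul_eq_zero.1 this).resolve_right (hdiag j).ne'

/-- The Cholesky factor is obtained from the LDL decomposition by distributing the square roots of
the diagonal entries, with signs that make the diagonal positive. -/
theorem Matrix.PosDef.exists_isCholesky {S : Matrix (Fin q) (Fin q) ℝ} (hS : S.PosDef) :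
    ∃ C, IsCholesky S C := by
  set A := LDL.lower hS with hA
  have hAlow : ∀ i j, i < j → A i j = 0 := by
    have htri : (LDL.lowerInv hS).BlockTriangular OrderDual.toDual := fun i j hij =>
      LDL.lowerInv_triangular hS hij
    intro i j hij
    exact Matrix.blockTriangular_inv_of_blockTriangular htri hij
  have hdec : A * Matrix.diagonal (LDL.diagEntries hS) * A.transpose = S := by
    have := LDL.lower_conj_diag hS
    rwa [Matrix.conjTranspose_eq_transpose_of_trivial] at this
  have hdet : (LDL.lowerInv hS).det ≠ 0 := (Matrix.isUnit_det_of_invertible _).ne_zero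
  have hAdet : A.det ≠ 0 := by
    rw [hA, LDL.lower, Matrix.det_nonsing_inv]
    simpa using hdet
  have hAdiag : ∀ i, A i i ≠ 0 := fun i h => hAdet <| by
    rw [Matrix.det_of_isLowerTriangular A fun i j hij => hAlow i j hij]
    exact Finset.prod_eq_zero (Finset.mem_univ i) h
  have hpos : ∀ i, 0 < LDL.diagEntries hS i := fun i => by
    have hrow : LDL.lowerInv hS i ≠ 0 := fun h =>
      hdet (Matrix.det_eq_zero_of_row_eq_zero i fun j => congrFun h j)
    have := hS.dotProduct_mulVec_pos hrow
    simpa [LDL.diagEntries, dotProduct_comm, EuclideanSpace.inner_toLp_toLp] using this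
  have hsign : ∀ i, (SignType.sign (A i i) : ℝ) * SignType.sign (A i i) = 1 := fun i => by
    rcases lt_or_gt_of_ne (hAdiag i) with h | h <;> simp [h]
  refine ⟨A * Matrix.diagonal fun i => √(LDL.diagEntries hS i) * SignType.sign (A i i),
    fun i j hij => ?_, fun i => ?_, ?_⟩
  · rw [Matrix.mul_diagonal, hAlow i j hij, zero_mul]
  · rw [Matrix.mul_diagonal, mul_left_comm, self_mul_sign]
    exact mul_pos (Real.sqrt_pos.2 (hpos i)) (abs_pos.2 (hAdiag i))
  · rw [Matrix.transpose_mul, Matrix.diagonal_transpose, Matrix.mul_assoc A,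
      ← Matrix.mul_assoc (Matrix.diagonal _), Matrix.diagonal_mul_diagonal, ← Matrix.mul_assoc]
    conv_rhs => rw [← hdec]
    congr 3
    ext i
    rw [mul_mul_mul_comm, Real.mul_self_sqrt (hpos i).le, hsign, mul_one]

theorem IsCholesky.cholesky_eq {S C : Matrix (Fin q) (Fin q) ℝ} (h : IsCholesky S C) :
    DRM.cholesky S = C :=
  (Classical.epsilon_spec (p := IsCholesky S) ⟨C, h⟩ : IsCholesky S (DRM.cholesky S)).unique h

/-- The Cholesky factor solves a system of `q²` polynomial equations: `C Cᵀ` agrees with `S` on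
and below the diagonal, and `C` vanishes above it. -/
theorem contDiffAt_cholesky {E : Type*} [NormedAddCommGroup E] [NormedSpace ℝ E] [CompleteSpace E]
    {n : WithTop ℕ∞} (hn : n ≠ 0) {x₀ : E} {S : E → Matrix (Fin q) (Fin q) ℝ}
    (hS : ∀ i j, ContDiffAt ℝ n (fun x => S x i j) x₀) (hpos : (S x₀).PosDef)
    (hsymm : ∀ᶠ x in 𝓝 x₀, (S x).IsSymm) (i j : Fin q) :
    ContDiffAt ℝ n (fun x => DRM.cholesky (S x) i j) x₀ := by
  obtain ⟨C, hC⟩ := hpos.exists_isCholesky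
  have hC0 : DRM.cholesky (S x₀) = C := hC.cholesky_eq
  obtain ⟨hlow, hdiag, hCS⟩ := hC
  -- function types instead of matrices, which carry no norm
  let G : E → (Fin q → Fin q → ℝ) → (Fin q → Fin q → ℝ) := fun x c i j =>
    if j ≤ i then ∑ k, c i k * c j k - S x i j else c i j
  let f : E → (Fin q → Fin q → ℝ) := fun x i j => DRM.cholesky (S x) i j
  have hf0 : f x₀ = C := hC0
  let e : Fin q → Fin q → (Fin q → Fin q → ℝ) →L[ℝ] ℝ := fun i j =>
    (ContinuousLinearMap.proj j).comp
      (ContinuousLinearMap.proj (R := ℝ) (φ := fun _ => Fin q → ℝ) i)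
  let D : (Fin q → Fin q → ℝ) →L[ℝ] (Fin q → Fin q → ℝ) :=
    ContinuousLinearMap.pi fun i => ContinuousLinearMap.pi fun j =>
      if j ≤ i then ∑ k, (C i k • e j k + C j k • e i k) else e i j
  have he : ∀ i j (c : Fin q → Fin q → ℝ), HasFDerivAt (fun c => c i j) (e i j) c := fun i j c =>
    (e i j).hasFDerivAt
  have hDapp : ∀ X i j, D X i j =
      if j ≤ i then ∑ k, (C i k * X j k + C j k * X i k) else X i j := fun X i j => by
    simp only [D, ContinuousLinearMap.pi_apply]
    split_ifs <;> simp [e]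
  have hG0 : G x₀ C = 0 := by
    ext i j
    simp only [G]
    split_ifs with hij
    · have := congrFun₂ hCS i j
      simp only [Matrix.mul_apply, Matrix.transpose_apply] at this
      rw [this, sub_self]; rfl
    · exact hlow i j (not_le.1 hij)
  have hmain : ContDiffAt ℝ n f x₀ := by
    refine contDiffAt_of_locally_unique_solution (G := G) (D := D) hn ?_ ?_ ?_ ?_
    · refine contDiffAt_pi.2 fun i => contDiffAt_pi.2 fun j => ?_
      have hent : ∀ i k, ContDiffAt ℝ n (fun v : E × (Fin q → Fin q → ℝ) => v.2 i k)
          (x₀, f x₀) := fun i k => by fun_prop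
      simp only [G]
      split_ifs with hij
      · exact (ContDiffAt.sum fun k _ => (hent i k).mul (hent j k)).sub
          (ContDiffAt.comp (x₀, f x₀) (hS i j) contDiffAt_fst)
      · exact hent i j
    · rw [hf0]
      refine hasFDerivAt_pi'.2 fun i => hasFDerivAt_pi'.2 fun j => ?_
      simp only [G]
      split_ifs with hij
      · refine HasFDerivAt.congr_fderiv ((HasFDerivAt.fun_sum fun k _ =>
          (he i k C).mul (he j k C)).sub_const _) ?_
        ext c
        simp [D, hij]
      · refine (he i j C).congr_fderiv ?_
        ext c
        simp [D, hij]
    · refine (injective_iff_map_eq_zero D).2 fun X hX => ?_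
      have hXupper : ∀ i j, i < j → X i j = 0 := fun i j hij => by
        have := congrFun₂ hX i j
        rwa [hDapp, if_neg (not_le.2 hij)] at this
      have hXlow : ∀ i j, j ≤ i → (Matrix.of X * C.transpose) i j +
          (C * (Matrix.of X).transpose) i j = 0 := fun i j hij => by
        have := congrFun₂ hX i j
        rw [hDapp, if_pos hij, Finset.sum_add_distrib, add_comm] at this
        simp only [Matrix.mul_apply, Matrix.transpose_apply, Matrix.of_apply, mul_comm (X i _)]
        exact this
      refine eq_zero_of_mul_transpose_add_eq_zero (X := Matrix.of X) hlow hdiag hXupper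
        fun i j => ?_
      rcases le_total j i with hij | hij
      · exact hXlow i j hij
      · have := hXlow j i hij
        simp only [Matrix.mul_apply, Matrix.transpose_apply] at this ⊢
        rw [add_comm]
        simpa only [mul_comm] using this
    · have hdiag' : ∀ᶠ v : E × (Fin q → Fin q → ℝ) in 𝓝 (x₀, f x₀), ∀ i, 0 < v.2 i i := by
        refine eventually_all.2 fun i => ?_
        have hcont : ContinuousAt (fun v : E × (Fin q → Fin q → ℝ) => v.2 i i) (x₀, f x₀) := by
          fun_prop
        exact hcont.eventually (lt_mem_nhds (by simpa [hf0] using hdiag i))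
      filter_upwards [hdiag', continuousAt_fst.eventually hsymm] with v hv hsym heq
      rw [hf0, hG0] at heq
      have hvl : ∀ i j, i < j → v.2 i j = 0 := fun i j hij => by
        have := congrFun₂ heq i j
        simpa [G, not_le.2 hij] using this
      have hvS : ∀ i j, j ≤ i → ∑ k, v.2 i k * v.2 j k = S v.1 i j := fun i j hij => by
        have := congrFun₂ heq i j
        simp only [G, hij, if_true] at this
        exact sub_eq_zero.1 this
      have : IsCholesky (S v.1) (Matrix.of v.2) := by
        refine ⟨hvl, hv, ?_⟩
        ext i j
        rw [Matrix.mul_apply]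
        rcases le_total j i with hij | hij
        · exact hvS i j hij
        · rw [← hsym.apply i j, ← hvS j i hij]
          exact Finset.sum_congr rfl fun k _ => mul_comm _ _
      exact this.cholesky_eq
  exact contDiffAt_pi.1 (contDiffAt_pi.1 hmain i) j

end cholesky

/-! ### Positive definite quadratic forms -/

section quadraticForm

variable {q : ℕ}

/-- A positive definite quadratic form is coercive (with respect to the sup norm). -/
theorem Matrix.PosDef.exists_mul_norm_sq_le {A : Matrix (Fin q) (Fin q) ℝ} (hA : A.PosDef) :
    ∃ c > 0, ∀ b : Fin q → ℝ, c * ‖b‖ ^ 2 ≤ b ⬝ᵥ A.mulVec b := by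
  obtain ⟨C, -, -, hC⟩ := hA.exists_isCholesky
  have hdet : C.transpose.det ≠ 0 := fun h =>
    hA.det_pos.ne' (by rw [← hC, Matrix.det_mul, h, mul_zero])
  have hker : LinearMap.ker C.transpose.mulVecLin = ⊥ :=
    LinearMap.ker_eq_bot'.2 fun v hv => Matrix.eq_zero_of_mulVec_eq_zero hdet hv
  obtain ⟨K, hK, hanti⟩ := LinearMap.exists_antilipschitzWith C.transpose.mulVecLin hker
  have hK' : (0 : ℝ) < K := hK
  refine ⟨((K : ℝ) ^ 2)⁻¹, by positivity, fun b => ?_⟩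
  have h1 : ‖b‖ ≤ K * ‖C.transpose.mulVec b‖ := by
    have := hanti.le_mul_dist b 0
    rwa [map_zero, dist_zero_right, dist_zero_right] at this
  have h2 : b ⬝ᵥ A.mulVec b = ∑ k, C.transpose.mulVec b k ^ 2 := by
    rw [← hC, ← Matrix.mulVec_mulVec, Matrix.dotProduct_mulVec, ← Matrix.mulVec_transpose]
    simp [dotProduct, sq]
  have h3 : ‖C.transpose.mulVec b‖ ^ 2 ≤ ∑ k, C.transpose.mulVec b k ^ 2 := by
    rw [← Real.le_sqrt (norm_nonneg _) (Finset.sum_nonneg fun _ _ => sq_nonneg _)]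
    refine (pi_norm_le_iff_of_nonneg (Real.sqrt_nonneg _)).2 fun k => ?_
    rw [Real.norm_eq_abs, ← Real.sqrt_sq_eq_abs]
    exact Real.sqrt_le_sqrt (Finset.single_le_sum
      (f := fun k => C.transpose.mulVec b k ^ 2) (fun _ _ => sq_nonneg _) (Finset.mem_univ k))
  rw [h2, inv_mul_le_iff₀ (by positivity)]
  calc ‖b‖ ^ 2 ≤ (K * ‖C.transpose.mulVec b‖) ^ 2 := by gcongr
    _ = K ^ 2 * ‖C.transpose.mulVec b‖ ^ 2 := mul_pow _ _ _
    _ ≤ _ := by gcongr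

/-- Nonnegative rank-one updates preserve positive definiteness and do not decrease the
determinant, by the matrix determinant lemma. -/
theorem Matrix.PosDef.add_sum_smul_vecMulVec {ι : Type*} {A : Matrix (Fin q) (Fin q) ℝ}
    (hA : A.PosDef) (t : Finset ι) {c : ι → ℝ} (hc : ∀ j, 0 ≤ c j) (u : ι → Fin q → ℝ) :
    (A + ∑ j ∈ t, c j • Matrix.vecMulVec (u j) (u j)).PosDef ∧
      A.det ≤ (A + ∑ j ∈ t, c j • Matrix.vecMulVec (u j) (u j)).det := by
  classical
  induction t using Finset.induction_on with
  | empty => simpa using hA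
  | insert j t hj ih =>
    obtain ⟨hpos, hdet⟩ := ih
    rw [Finset.sum_insert hj, add_left_comm, add_comm (c j • _)]
    set N := A + ∑ j ∈ t, c j • Matrix.vecMulVec (u j) (u j)
    have hup : (c j • Matrix.vecMulVec (u j) (u j)).PosSemidef := by
      have := Matrix.posSemidef_vecMulVec_self_star (R := ℝ) (u j)
      rw [star_trivial] at this
      exact this.smul (hc j)
    refine ⟨hpos.add_posSemidef hup, hdet.trans ?_⟩
    have hform : c j • Matrix.vecMulVec (u j) (u j) =
        Matrix.replicateCol Unit (c j • u j) * Matrix.replicateRow Unit (u j) := by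
      ext a b
      simp [Matrix.vecMulVec_apply, Matrix.mul_apply, mul_assoc]
    have hnonneg : 0 ≤ u j ⬝ᵥ N⁻¹.mulVec (u j) := by
      simpa using hpos.inv.posSemidef.dotProduct_mulVec_nonneg (u j)
    have hone : (1 + Matrix.replicateRow Unit (u j) * N⁻¹ *
        Matrix.replicateCol Unit (c j • u j)).det = 1 + c j * (u j ⬝ᵥ N⁻¹.mulVec (u j)) := by
      rw [Matrix.det_unique, Matrix.mul_assoc, Matrix.add_apply, Matrix.one_apply_eq,
        ← Matrix.replicateCol_mulVec, Matrix.replicateRow_mul_replicateCol_apply,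
        Matrix.mulVec_smul, dotProduct_smul, smul_eq_mul]
    rw [hform, Matrix.det_add_replicateCol_mul_replicateRow hpos.det_pos.ne'.isUnit, hone]
    exact le_mul_of_one_le_right hpos.det_pos.le
      (le_add_of_nonneg_right (mul_nonneg (hc j) hnonneg))

end quadraticForm

/-! ### The mode of the joint density and the bound for the DRM approximation -/

theorem hasDerivAt_log_one_add_exp (x : ℝ) :
    HasDerivAt (fun x => Real.log (1 + Real.exp x)) (Real.sigmoid x) x := by
  have h : HasDerivAt (fun x => Real.log (1 + Real.exp x)) (Real.exp x / (1 + Real.exp x)) x :=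
    ((Real.hasDerivAt_exp x).const_add 1).log (by positivity)
  convert! h using 1
  rw [Real.sigmoid_def, Real.exp_neg]
  field_simp
  ring

namespace DRM.GLLVM

variable {d p q : ℕ} (M : DRM.GLLVM d p q) {θ : EuclideanSpace ℝ (Fin d)} (y : Fin p → Bool)

theorem measurementDensity_pos (θ : EuclideanSpace ℝ (Fin d)) (b : Fin q → ℝ) :
    0 < M.measurementDensity θ y b := Real.exp_pos _

theorem measurementDensity_le_one (θ : EuclideanSpace ℝ (Fin d)) (b : Fin q → ℝ) :
    M.measurementDensity θ y b ≤ 1 := by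
  refine Real.exp_le_one_iff.2 (Finset.sum_nonpos fun j _ => ?_)
  have h1 : M.eta θ b j ≤ Real.log (1 + Real.exp (M.eta θ b j)) := by
    rw [Real.le_log_iff_exp_le (by positivity)]
    linarith
  have h2 : 0 ≤ Real.log (1 + Real.exp (M.eta θ b j)) :=
    Real.log_nonneg (by linarith [Real.exp_pos (M.eta θ b j)])
  split_ifs <;> linarith

variable {M}

theorem latentNorm_pos (hΨ : (M.latentCov θ).PosDef) :
    0 < √((2 * Real.pi) ^ q * (M.latentCov θ).det) :=
  Real.sqrt_pos.2 (mul_pos (by positivity) hΨ.det_pos)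

theorem latentDensity_pos (hΨ : (M.latentCov θ).PosDef) (b : Fin q → ℝ) :
    0 < M.latentDensity θ b :=
  mul_pos (inv_pos.2 (latentNorm_pos hΨ)) (Real.exp_pos _)

theorem latentDensity_le (hΨ : (M.latentCov θ).PosDef) (b : Fin q → ℝ) :
    M.latentDensity θ b ≤ (√((2 * Real.pi) ^ q * (M.latentCov θ).det))⁻¹ := by
  refine mul_le_of_le_one_right (inv_pos.2 (latentNorm_pos hΨ)).le (Real.exp_le_one_iff.2 ?_)
  have : 0 ≤ b ⬝ᵥ (M.latentCov θ)⁻¹.mulVec b := by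
    simpa using hΨ.inv.posSemidef.dotProduct_mulVec_nonneg b
  linarith

theorem exp_logJoint (hΨ : (M.latentCov θ).PosDef) (b : Fin q → ℝ) :
    Real.exp (M.logJoint θ y b) = M.measurementDensity θ y b * M.latentDensity θ b := by
  rw [logJoint, Real.exp_add, Real.exp_log (M.measurementDensity_pos y θ b),
    Real.exp_log (latentDensity_pos hΨ b)]

theorem logJoint_eq (hΨ : (M.latentCov θ).PosDef) (b : Fin q → ℝ) :
    M.logJoint θ y b =
      ∑ j, ((if y j then M.eta θ b j else 0) - Real.log (1 + Real.exp (M.eta θ b j))) +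
      (Real.log (√((2 * Real.pi) ^ q * (M.latentCov θ).det))⁻¹ -
        1 / 2 * (b ⬝ᵥ (M.latentCov θ)⁻¹.mulVec b)) := by
  rw [logJoint, measurementDensity, latentDensity, Real.log_exp,
    Real.log_mul (inv_pos.2 (latentNorm_pos hΨ)).ne' (Real.exp_pos _).ne', Real.log_exp]
  ring

/-- The gradient of `b ↦ L(b)`. -/
noncomputable def modeScore (M : DRM.GLLVM d p q) (y : Fin p → Bool) (θ : EuclideanSpace ℝ (Fin d))
    (b : Fin q → ℝ) (k : Fin q) : ℝ :=
  ∑ j, M.loading θ k j * ((if y j then 1 else 0) - Real.sigmoid (M.eta θ b j)) -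
    (M.latentCov θ)⁻¹.mulVec b k

/-- The information matrix `-L''(b)`, which does not involve the response pattern. -/
noncomputable def modeInfo (M : DRM.GLLVM d p q) (θ : EuclideanSpace ℝ (Fin d)) (b : Fin q → ℝ) :
    Matrix (Fin q) (Fin q) ℝ :=
  (M.latentCov θ)⁻¹ + ∑ j, (Real.sigmoid (M.eta θ b j) * (1 - Real.sigmoid (M.eta θ b j))) •
    Matrix.vecMulVec (fun k => M.loading θ k j) (fun k => M.loading θ k j)

theorem posDef_modeInfo_and_det_le (hΨ : (M.latentCov θ).PosDef) (b : Fin q → ℝ) :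
    (M.modeInfo θ b).PosDef ∧ (M.latentCov θ)⁻¹.det ≤ (M.modeInfo θ b).det :=
  hΨ.inv.add_sum_smul_vecMulVec Finset.univ (fun _ => mul_nonneg (Real.sigmoid_nonneg _)
    (sub_nonneg.2 (Real.sigmoid_le_one _))) _

theorem hasFDerivAt_eta (θ : EuclideanSpace ℝ (Fin d)) (b : Fin q → ℝ) (j : Fin p) :
    HasFDerivAt (fun b => M.eta θ b j)
      (∑ k, M.loading θ k j • ContinuousLinearMap.proj (R := ℝ) (φ := fun _ : Fin q => ℝ) k) b := by
  unfold eta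
  simp only [Matrix.mulVec, dotProduct, Matrix.transpose_apply]
  exact (HasFDerivAt.fun_sum fun k _ => (hasFDerivAt_apply k b).const_mul _).const_add _

theorem hasFDerivAt_mulVec (A : Matrix (Fin q) (Fin q) ℝ) (b : Fin q → ℝ) (k : Fin q) :
    HasFDerivAt (fun b => A.mulVec b k)
      (∑ l, A k l • ContinuousLinearMap.proj (R := ℝ) (φ := fun _ : Fin q => ℝ) l) b := by
  simp only [Matrix.mulVec, dotProduct]
  exact HasFDerivAt.fun_sum fun l _ => (hasFDerivAt_apply l b).const_mul _

theorem hasFDerivAt_logJoint (hΨ : (M.latentCov θ).PosDef) (b : Fin q → ℝ) :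
    HasFDerivAt (M.logJoint θ y) (∑ k, M.modeScore y θ b k •
      ContinuousLinearMap.proj (R := ℝ) (φ := fun _ : Fin q => ℝ) k) b := by
  have heq : M.logJoint θ y = _ := funext (logJoint_eq y hΨ)
  rw [heq]
  have hitem : ∀ j, HasFDerivAt
      (fun b => (if y j then M.eta θ b j else 0) - Real.log (1 + Real.exp (M.eta θ b j)))
      (((if y j then 1 else 0) - Real.sigmoid (M.eta θ b j)) •
        ∑ k, M.loading θ k j • ContinuousLinearMap.proj (R := ℝ) (φ := fun _ : Fin q => ℝ) k)
      b := fun j => by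
    have hlog := (hasDerivAt_log_one_add_exp (M.eta θ b j)).comp_hasFDerivAt b
      (hasFDerivAt_eta θ b j)
    split_ifs with hy
    · refine ((hasFDerivAt_eta θ b j).sub hlog).congr_fderiv (by ext v; simp; ring)
    · refine ((hasFDerivAt_const 0 b).sub hlog).congr_fderiv (by ext v; simp)
  have hquad : HasFDerivAt (fun b : Fin q → ℝ => b ⬝ᵥ (M.latentCov θ)⁻¹.mulVec b) _ b :=
    HasFDerivAt.fun_sum fun k _ => (hasFDerivAt_apply k b).mul
      (hasFDerivAt_mulVec (M.latentCov θ)⁻¹ b k)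
  refine ((HasFDerivAt.fun_sum fun j _ => hitem j).add
    ((hquad.const_mul (1 / 2)).const_sub _)).congr_fderiv ?_
  have hsymm : ∀ k l, (M.latentCov θ)⁻¹ k l = (M.latentCov θ)⁻¹ l k := fun k l => by
    simpa using (hΨ.inv.isHermitian.apply k l).symm
  have hq : ∀ v : Fin q → ℝ, ∑ k, b k * ∑ l, (M.latentCov θ)⁻¹ k l * v l =
      ∑ k, v k * (M.latentCov θ)⁻¹.mulVec b k := fun v => by
    simp_rw [Matrix.mulVec, dotProduct, Finset.mul_sum]
    rw [Finset.sum_comm]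
    exact Finset.sum_congr rfl fun k _ => Finset.sum_congr rfl fun l _ => by
      rw [hsymm l k]; ring
  have hη : ∀ v : Fin q → ℝ, ∑ j, ((if y j then 1 else 0) - Real.sigmoid (M.eta θ b j)) *
      ∑ k, M.loading θ k j * v k = ∑ k, (∑ j, M.loading θ k j *
        ((if y j then 1 else 0) - Real.sigmoid (M.eta θ b j))) * v k := fun v => by
    simp_rw [Finset.mul_sum, Finset.sum_mul]
    rw [Finset.sum_comm]
    exact Finset.sum_congr rfl fun k _ => Finset.sum_congr rfl fun j _ => by ring
  ext v
  simp only [modeScore, add_apply, sum_apply,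
    smul_apply, neg_apply, ContinuousLinearMap.proj_apply,
    smul_eq_mul, hη, hq, Finset.sum_add_distrib]
  simp_rw [sub_mul, Finset.sum_sub_distrib, mul_comm (v _)]
  ring

theorem hasFDerivAt_modeScore (y : Fin p → Bool) (θ : EuclideanSpace ℝ (Fin d))
    (b : Fin q → ℝ) :
    HasFDerivAt (M.modeScore y θ) (-(M.modeInfo θ b).mulVecLin.toContinuousLinearMap) b := by
  refine hasFDerivAt_pi'.2 fun k => ?_
  have hsig : ∀ j, HasFDerivAt (fun b => Real.sigmoid (M.eta θ b j)) _ b := fun j =>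
    HasDerivAt.comp_hasFDerivAt (h₂ := Real.sigmoid) b (Real.hasDerivAt_sigmoid (M.eta θ b j))
      (hasFDerivAt_eta θ b j)
  refine ((HasFDerivAt.fun_sum fun j _ => ((hsig j).const_sub _).const_mul (M.loading θ k j)).sub
    (hasFDerivAt_mulVec (M.latentCov θ)⁻¹ b k)).congr_fderiv ?_
  ext v
  simp only [modeInfo, sub_apply, sum_apply,
    smul_apply, neg_apply, ContinuousLinearMap.proj_apply,
    smul_eq_mul, ContinuousLinearMap.comp_apply, LinearMap.coe_toContinuousLinearMap',
    Matrix.mulVecLin_apply, Matrix.add_mulVec, Pi.neg_apply, Pi.add_apply, Matrix.sum_mulVec,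
    Finset.sum_apply, Matrix.smul_mulVec, Pi.smul_apply, Matrix.vecMulVec_mulVec]
  simp only [Matrix.mulVec, dotProduct, MulOpposite.smul_eq_mul_unop, MulOpposite.unop_op, neg_add,
    ← Finset.sum_neg_distrib]
  rw [sub_eq_neg_add, ← Finset.sum_neg_distrib]
  congr 1
  exact Finset.sum_congr rfl fun j _ => by ring

/-- The gradient of `L` is injective, since `L` is strictly concave. In particular `L` has at most
one critical point. -/
theorem eq_of_modeScore_eq (hΨ : (M.latentCov θ).PosDef) {b b' : Fin q → ℝ}
    (h : M.modeScore y θ b = M.modeScore y θ b') : b = b' := by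
  by_contra hne
  set Δ := b - b' with hΔ
  have hpos : 0 < Δ ⬝ᵥ (M.latentCov θ)⁻¹.mulVec Δ := by
    have := hΨ.inv.dotProduct_mulVec_pos (sub_ne_zero.2 hne)
    rwa [star_trivial] at this
  have hη : ∀ j, M.eta θ b j - M.eta θ b' j = ∑ k, M.loading θ k j * Δ k := fun j => by
    simp only [eta, Matrix.mulVec, dotProduct, Matrix.transpose_apply, hΔ, Pi.sub_apply, mul_sub,
      Finset.sum_sub_distrib]
    ring
  have hzero : ∑ k, Δ k * (M.modeScore y θ b k - M.modeScore y θ b' k) = 0 := by simp [h]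
  have hexp : ∑ k, Δ k * (M.modeScore y θ b k - M.modeScore y θ b' k) =
      -∑ j, (Real.sigmoid (M.eta θ b j) - Real.sigmoid (M.eta θ b' j)) *
        (M.eta θ b j - M.eta θ b' j) - Δ ⬝ᵥ (M.latentCov θ)⁻¹.mulVec Δ := by
    have h1 : ∀ k, M.modeScore y θ b k - M.modeScore y θ b' k =
        -∑ j, M.loading θ k j * (Real.sigmoid (M.eta θ b j) - Real.sigmoid (M.eta θ b' j)) -
          (M.latentCov θ)⁻¹.mulVec Δ k := fun k => by
      simp only [modeScore, hΔ, Matrix.mulVec_sub, Pi.sub_apply, mul_sub, Finset.sum_sub_distrib]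
      ring
    have h2 : ∑ j, (Real.sigmoid (M.eta θ b j) - Real.sigmoid (M.eta θ b' j)) *
        ∑ k, M.loading θ k j * Δ k = ∑ k, Δ k * ∑ j, M.loading θ k j *
          (Real.sigmoid (M.eta θ b j) - Real.sigmoid (M.eta θ b' j)) := by
      simp_rw [Finset.mul_sum]
      rw [Finset.sum_comm]
      exact Finset.sum_congr rfl fun k _ => Finset.sum_congr rfl fun j _ => by ring
    simp_rw [hη]
    rw [h2, dotProduct, ← Finset.sum_neg_distrib, ← Finset.sum_sub_distrib]
    exact Finset.sum_congr rfl fun k _ => by rw [h1]; ring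
  have hmono : 0 ≤ ∑ j, (Real.sigmoid (M.eta θ b j) - Real.sigmoid (M.eta θ b' j)) *
      (M.eta θ b j - M.eta θ b' j) := by
    refine Finset.sum_nonneg fun j _ => ?_
    rcases le_total (M.eta θ b j) (M.eta θ b' j) with hle | hle
    · exact mul_nonneg_of_nonpos_of_nonpos (sub_nonpos.2 (Real.sigmoid_monotone hle))
        (sub_nonpos.2 hle)
    · exact mul_nonneg (sub_nonneg.2 (Real.sigmoid_monotone hle)) (sub_nonneg.2 hle)
  linarith

/-- `L` has a maximizer because `log g ≤ 0` and `log h` tends to `-∞`; so `DRM.GLLVM.mode`, which is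
chosen by `Classical.epsilon`, is one. -/
theorem logJoint_le_logJoint_mode (hΨ : (M.latentCov θ).PosDef) (b : Fin q → ℝ) :
    M.logJoint θ y b ≤ M.logJoint θ y (M.mode θ y) := by
  have hcont : Continuous (M.logJoint θ y) :=
    continuous_iff_continuousAt.2 fun b => (hasFDerivAt_logJoint y hΨ b).continuousAt
  obtain ⟨c, hc, hquad⟩ := hΨ.inv.exists_mul_norm_sq_le
  have hlim : Tendsto (M.logJoint θ y) (cocompact (Fin q → ℝ)) atBot := by
    have hnorm : Tendsto (fun b : Fin q → ℝ =>
        Real.log (√((2 * Real.pi) ^ q * (M.latentCov θ).det))⁻¹ - 1 / 2 * c * ‖b‖ ^ 2)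
        (cocompact (Fin q → ℝ)) atBot := by
      refine tendsto_atBot_add_const_left _ _ (tendsto_neg_atTop_atBot.comp ?_)
      exact ((tendsto_pow_atTop two_ne_zero).comp tendsto_norm_cocompact_atTop).const_mul_atTop
        (by positivity)
    refine tendsto_atBot_mono (fun b => ?_) hnorm
    have h1 : ∑ j, ((if y j then M.eta θ b j else 0) - Real.log (1 + Real.exp (M.eta θ b j))) ≤ 0 :=
      Real.exp_le_one_iff.1 (M.measurementDensity_le_one y θ b)
    rw [logJoint_eq y hΨ]
    linarith [hquad b]
  exact Classical.epsilon_spec (p := fun b => ∀ b', M.logJoint θ y b' ≤ M.logJoint θ y b)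
    (hcont.exists_forall_ge hlim) b

theorem modeScore_mode (hΨ : (M.latentCov θ).PosDef) : M.modeScore y θ (M.mode θ y) = 0 := by
  have hmax : IsLocalMax (M.logJoint θ y) (M.mode θ y) :=
    Eventually.of_forall (logJoint_le_logJoint_mode y hΨ)
  have h0 := hmax.hasFDerivAt_eq_zero (hasFDerivAt_logJoint y hΨ _)
  ext k
  simpa [Pi.single_apply] using DFunLike.congr_fun h0 (Pi.single k 1)

theorem modeCov_eq (hΨ : (M.latentCov θ).PosDef) :
    M.modeCov θ y = (M.modeInfo θ (M.mode θ y))⁻¹ := by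
  rw [modeCov]
  congr 1
  have hgrad : ∀ k, (fun b => fderiv ℝ (M.logJoint θ y) b (Pi.single k 1)) =
      fun b => M.modeScore y θ b k := fun k => by
    ext b
    rw [(hasFDerivAt_logJoint y hΨ b).fderiv]
    simp [Pi.single_apply]
  have hinfo := (posDef_modeInfo_and_det_le hΨ (M.mode θ y)).1
  ext i k
  rw [Matrix.neg_apply, DRM.hessian, Matrix.of_apply, hgrad,
    (hasFDerivAt_pi'.1 (hasFDerivAt_modeScore y θ (M.mode θ y)) k).fderiv]
  simpa using hinfo.isHermitian.apply i k

theorem modeCov_posDef (hΨ : (M.latentCov θ).PosDef) : (M.modeCov θ y).PosDef := by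
  rw [modeCov_eq y hΨ]
  exact (posDef_modeInfo_and_det_le hΨ _).1.inv

theorem det_modeCov_le (hΨ : (M.latentCov θ).PosDef) :
    (M.modeCov θ y).det ≤ (M.latentCov θ).det := by
  have h := (posDef_modeInfo_and_det_le hΨ (M.mode θ y)).2
  rw [Matrix.det_nonsing_inv, Ring.inverse_eq_inv'] at h
  rw [modeCov_eq y hΨ, Matrix.det_nonsing_inv, Ring.inverse_eq_inv']
  exact inv_le_of_inv_le₀ hΨ.det_pos h

/-- The Laplace approximation `(2π)^{q/2} |Σ̂|^{1/2} exp (L(b̂))` is bounded in `θ`, since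
`|Σ̂| ≤ |Ψ|` and `exp (L(b̂)) ≤ h(b̂) ≤ (2π)^{-q/2} |Ψ|^{-1/2}`. -/
theorem laplace_le (hΨ : (M.latentCov θ).PosDef) :
    (2 * Real.pi) ^ ((q : ℝ) / 2) * √(M.modeCov θ y).det *
      Real.exp (M.logJoint θ y (M.mode θ y)) ≤
    (2 * Real.pi) ^ ((q : ℝ) / 2) * (√((2 * Real.pi) ^ q))⁻¹ := by
  have hdet := hΨ.det_pos
  have h1 : Real.exp (M.logJoint θ y (M.mode θ y)) ≤
      (√((2 * Real.pi) ^ q * (M.latentCov θ).det))⁻¹ := by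
    rw [exp_logJoint y hΨ]
    exact (mul_le_of_le_one_left (latentDensity_pos hΨ _).le
      (M.measurementDensity_le_one y θ _)).trans (latentDensity_le hΨ _)
  calc _ ≤ (2 * Real.pi) ^ ((q : ℝ) / 2) * √(M.latentCov θ).det *
        (√((2 * Real.pi) ^ q * (M.latentCov θ).det))⁻¹ := by
        gcongr
        exact det_modeCov_le y hΨ
    _ = _ := by
        have := (Real.sqrt_pos.2 hdet).ne'
        rw [Real.sqrt_mul (by positivity), mul_inv]
        field_simp

/-- The DRM approximation is bounded above uniformly in the parameter. -/
theorem exists_approxDensity_le (M : DRM.GLLVM d p q) (s m : ℕ) (y : Fin p → Bool) :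
    ∃ K, ∀ θ, (M.latentCov θ).PosDef → M.approxDensity s m θ y ≤ K := by
  refine ⟨(2 * Real.pi) ^ ((q : ℝ) / 2) * (√((2 * Real.pi) ^ q))⁻¹ *
    (|(-1) ^ s * ((q - 1).choose s : ℝ)| +
      ∑ i ∈ Finset.Icc 1 s, |(-1) ^ (s - i) * ((q - i - 1).choose (s - i) : ℝ)| *
        ∑ I ∈ Finset.powersetCard i (Finset.univ : Finset (Fin q)),
          ∑ t ∈ Fintype.piFinset (fun _ : I => DRM.ghNodes m),
            Real.pi ^ (-(i : ℝ) / 2) * |∏ k : I, DRM.ghWeightStar m (t k)|), fun θ hΨ => ?_⟩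
  rw [approxDensity]
  have hratio : ∀ b, Real.exp (-M.logJoint θ y (M.mode θ y)) *
      (M.measurementDensity θ y b * M.latentDensity θ b) ≤ 1 := fun b => by
    rw [← exp_logJoint y hΨ, ← Real.exp_add]
    exact Real.exp_le_one_iff.2 (by linarith [logJoint_le_logJoint_mode y hΨ b])
  refine (mul_le_mul_of_nonneg_left (le_abs_self _) (by positivity)).trans
    (mul_le_mul (laplace_le y hΨ) ?_ (abs_nonneg _) (by positivity))
  refine (abs_add_le _ _).trans (add_le_add le_rfl ?_)
  refine (Finset.abs_sum_le_sum_abs _ _).trans (Finset.sum_le_sum fun i _ => ?_)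
  rw [abs_mul]
  refine mul_le_mul_of_nonneg_left ?_ (abs_nonneg _)
  refine (Finset.abs_sum_le_sum_abs _ _).trans (Finset.sum_le_sum fun I _ => ?_)
  refine (Finset.abs_sum_le_sum_abs _ _).trans (Finset.sum_le_sum fun t _ => ?_)
  rw [abs_mul]
  refine mul_le_mul_of_nonneg_right ?_ (abs_nonneg _)
  have hpos := mul_pos (M.measurementDensity_pos y θ (M.adaptedNode θ y I t))
    (latentDensity_pos hΨ (M.adaptedNode θ y I t))
  have hpi : 0 < Real.pi ^ (-(i : ℝ) / 2) := by positivity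
  have hre : Real.exp (-M.logJoint θ y (M.mode θ y)) * Real.pi ^ (-(i : ℝ) / 2) *
      M.measurementDensity θ y (M.adaptedNode θ y I t) *
      M.latentDensity θ (M.adaptedNode θ y I t) =
      Real.pi ^ (-(i : ℝ) / 2) * (Real.exp (-M.logJoint θ y (M.mode θ y)) *
        (M.measurementDensity θ y (M.adaptedNode θ y I t) *
          M.latentDensity θ (M.adaptedNode θ y I t))) := by ring
  rw [hre, abs_of_pos (mul_pos hpi (mul_pos (Real.exp_pos _) hpos))]
  exact mul_le_of_le_one_right hpi.le (hratio _)

end DRM.GLLVM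

/-! ### Smoothness of the DRM approximation in the parameter -/

namespace DRM.GLLVM

variable {d p q : ℕ} {M : DRM.GLLVM d p q} {θ₀ : EuclideanSpace ℝ (Fin d)} (y : Fin p → Bool)

/-- The model is regular at `θ₀`: near `θ₀` the latent covariance matrix is positive definite, and
at `θ₀` the intercepts, the loadings and the latent covariances are twice continuously
differentiable. -/
structure RegularAt (M : DRM.GLLVM d p q) (θ₀ : EuclideanSpace ℝ (Fin d)) : Prop where
  intercept : ∀ j, ContDiffAt ℝ 2 (fun θ => M.intercept θ j) θ₀
  loading : ∀ k j, ContDiffAt ℝ 2 (fun θ => M.loading θ k j) θ₀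
  latentCov : ∀ k l, ContDiffAt ℝ 2 (fun θ => M.latentCov θ k l) θ₀
  posDef : ∀ᶠ θ in 𝓝 θ₀, (M.latentCov θ).PosDef

namespace RegularAt

section joint

variable {F : Type*} [NormedAddCommGroup F] [NormedSpace ℝ F] {x₀ : F}
  {τ : F → EuclideanSpace ℝ (Fin d)} {b : F → Fin q → ℝ}

theorem contDiffAt_eta (h : M.RegularAt (τ x₀)) (hτ : ContDiffAt ℝ 2 τ x₀)
    (hb : ∀ k, ContDiffAt ℝ 2 (fun x => b x k) x₀) (j : Fin p) :
    ContDiffAt ℝ 2 (fun x => M.eta (τ x) (b x) j) x₀ := by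
  simp only [eta, Matrix.mulVec, dotProduct, Matrix.transpose_apply]
  exact ((h.intercept j).comp x₀ hτ).add
    (ContDiffAt.sum fun k _ => ((h.loading k j).comp x₀ hτ).mul (hb k))

theorem contDiffAt_inv_latentCov (h : M.RegularAt θ₀) (k l : Fin q) :
    ContDiffAt ℝ 2 (fun θ => (M.latentCov θ)⁻¹ k l) θ₀ :=
  ContDiffAt.matrix_inv h.latentCov h.posDef.self_of_nhds.det_pos.ne' k l

theorem contDiffAt_measurementDensity (h : M.RegularAt (τ x₀)) (hτ : ContDiffAt ℝ 2 τ x₀)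
    (hb : ∀ k, ContDiffAt ℝ 2 (fun x => b x k) x₀) :
    ContDiffAt ℝ 2 (fun x => M.measurementDensity (τ x) y (b x)) x₀ := by
  unfold measurementDensity
  refine (ContDiffAt.sum fun j _ => ContDiffAt.sub ?_ ?_).exp
  · split_ifs
    · exact h.contDiffAt_eta hτ hb j
    · exact contDiffAt_const
  · exact (contDiffAt_const.add (h.contDiffAt_eta hτ hb j).exp).log (by positivity)

theorem contDiffAt_latentDensity (h : M.RegularAt (τ x₀)) (hτ : ContDiffAt ℝ 2 τ x₀)
    (hb : ∀ k, ContDiffAt ℝ 2 (fun x => b x k) x₀) :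
    ContDiffAt ℝ 2 (fun x => M.latentDensity (τ x) (b x)) x₀ := by
  have hpos := h.posDef.self_of_nhds
  have hdet : ContDiffAt ℝ 2 (fun x => (M.latentCov (τ x)).det) x₀ :=
    (ContDiffAt.matrix_det h.latentCov).comp x₀ hτ
  have hprod : (2 * Real.pi) ^ q * (M.latentCov (τ x₀)).det ≠ 0 :=
    (mul_pos (by positivity) hpos.det_pos).ne'
  unfold latentDensity
  simp only [Matrix.mulVec, dotProduct]
  refine (((contDiffAt_const.mul hdet).sqrt hprod).inv (latentNorm_pos hpos).ne').mul
    (contDiffAt_const.mul (ContDiffAt.sum fun k _ => (hb k).mul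
      (ContDiffAt.sum fun l _ => ?_))).exp
  exact ((h.contDiffAt_inv_latentCov k l).comp x₀ hτ).mul (hb l)

theorem contDiffAt_logJoint (h : M.RegularAt (τ x₀)) (hτ : ContDiffAt ℝ 2 τ x₀)
    (hb : ∀ k, ContDiffAt ℝ 2 (fun x => b x k) x₀) :
    ContDiffAt ℝ 2 (fun x => M.logJoint (τ x) y (b x)) x₀ :=
  ((h.contDiffAt_measurementDensity y hτ hb).log (M.measurementDensity_pos y _ _).ne').add
    ((h.contDiffAt_latentDensity hτ hb).log (latentDensity_pos h.posDef.self_of_nhds _).ne')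

theorem contDiffAt_sigmoid_eta (h : M.RegularAt (τ x₀)) (hτ : ContDiffAt ℝ 2 τ x₀)
    (hb : ∀ k, ContDiffAt ℝ 2 (fun x => b x k) x₀) (j : Fin p) :
    ContDiffAt ℝ 2 (fun x => Real.sigmoid (M.eta (τ x) (b x) j)) x₀ :=
  (contDiff_sigmoid.of_le le_top).contDiffAt.comp x₀ (h.contDiffAt_eta hτ hb j)

theorem contDiffAt_modeScore (h : M.RegularAt (τ x₀)) (hτ : ContDiffAt ℝ 2 τ x₀)
    (hb : ∀ k, ContDiffAt ℝ 2 (fun x => b x k) x₀) (k : Fin q) :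
    ContDiffAt ℝ 2 (fun x => M.modeScore y (τ x) (b x) k) x₀ := by
  simp only [modeScore, Matrix.mulVec, dotProduct]
  refine (ContDiffAt.sum fun j _ => ((h.loading k j).comp x₀ hτ).mul
    (contDiffAt_const.sub (h.contDiffAt_sigmoid_eta hτ hb j))).sub
    (ContDiffAt.sum fun l _ => ?_)
  exact ((h.contDiffAt_inv_latentCov k l).comp x₀ hτ).mul (hb l)

theorem contDiffAt_modeInfo (h : M.RegularAt (τ x₀)) (hτ : ContDiffAt ℝ 2 τ x₀)
    (hb : ∀ k, ContDiffAt ℝ 2 (fun x => b x k) x₀) (k l : Fin q) :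
    ContDiffAt ℝ 2 (fun x => M.modeInfo (τ x) (b x) k l) x₀ := by
  simp only [modeInfo, Matrix.add_apply, Matrix.sum_apply, Matrix.smul_apply,
    Matrix.vecMulVec_apply, smul_eq_mul]
  refine ((h.contDiffAt_inv_latentCov k l).comp x₀ hτ).add (ContDiffAt.sum fun j _ => ?_)
  have hsig := h.contDiffAt_sigmoid_eta hτ hb j
  exact (hsig.mul (contDiffAt_const.sub hsig)).mul
    (((h.loading k j).comp x₀ hτ).mul ((h.loading l j).comp x₀ hτ))

end joint

/-- The mode is the unique zero of the gradient of `L`, whose derivative in `b` is the negative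
definite matrix `-modeInfo`. -/
theorem contDiffAt_mode (h : M.RegularAt θ₀) :
    ContDiffAt ℝ 2 (fun θ => M.mode θ y) θ₀ := by
  have hpos := h.posDef.self_of_nhds
  have hzero := modeScore_mode y hpos
  refine contDiffAt_of_locally_unique_solution (G := M.modeScore y) two_ne_zero ?_
    (hasFDerivAt_modeScore y θ₀ _) ?_ ?_
  · exact contDiffAt_pi.2 fun k => contDiffAt_modeScore (x₀ := (θ₀, M.mode θ₀ y))
      (τ := Prod.fst) (b := Prod.snd) y h contDiffAt_fst (fun k => by fun_prop) k
  · have hdet := (posDef_modeInfo_and_det_le hpos (M.mode θ₀ y)).1.det_pos.ne'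
    refine (injective_iff_map_eq_zero _).2 fun v hv => ?_
    exact Matrix.eq_zero_of_mulVec_eq_zero hdet (neg_eq_zero.1 hv)
  · filter_upwards [continuousAt_fst.eventually h.posDef] with v hv heq
    refine eq_of_modeScore_eq y hv ?_
    rw [modeScore_mode y hv, heq, hzero]

theorem contDiffAt_mode_apply (h : M.RegularAt θ₀) (k : Fin q) :
    ContDiffAt ℝ 2 (fun θ => M.mode θ y k) θ₀ :=
  contDiffAt_pi.1 (h.contDiffAt_mode y) k

theorem contDiffAt_modeCov (h : M.RegularAt θ₀) (k l : Fin q) :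
    ContDiffAt ℝ 2 (fun θ => M.modeCov θ y k l) θ₀ := by
  have hinv := ContDiffAt.matrix_inv (S := fun θ => M.modeInfo θ (M.mode θ y))
    (fun k l => contDiffAt_modeInfo (τ := id) h contDiffAt_id (h.contDiffAt_mode_apply y) k l)
    (posDef_modeInfo_and_det_le h.posDef.self_of_nhds _).1.det_pos.ne' k l
  exact hinv.congr_of_eventuallyEq (h.posDef.mono fun θ hθ => by
    simp only [modeCov_eq y hθ])

theorem contDiffAt_adaptedNode (h : M.RegularAt θ₀) (I : Finset (Fin q)) (t : I → ℝ)
    (k : Fin q) : ContDiffAt ℝ 2 (fun θ => M.adaptedNode θ y I t k) θ₀ := by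
  have hchol := contDiffAt_cholesky two_ne_zero (h.contDiffAt_modeCov y)
    (modeCov_posDef y h.posDef.self_of_nhds)
    (h.posDef.mono fun θ hθ => by simpa using! (modeCov_posDef y hθ).isHermitian)
  simp only [adaptedNode, Pi.add_apply, Pi.smul_apply, Matrix.mulVec, dotProduct, smul_eq_mul]
  exact (contDiffAt_const.mul (ContDiffAt.sum fun l _ => (hchol k l).mul contDiffAt_const)).add
    (h.contDiffAt_mode_apply y k)

theorem contDiffAt_approxDensity (h : M.RegularAt θ₀) (s m : ℕ) :
    ContDiffAt ℝ 2 (fun θ => M.approxDensity s m θ y) θ₀ := by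
  have hmode : ContDiffAt ℝ 2 (fun θ => M.logJoint θ y (M.mode θ y)) θ₀ :=
    contDiffAt_logJoint (τ := id) y h contDiffAt_id (h.contDiffAt_mode_apply y)
  have hdet := (ContDiffAt.matrix_det (h.contDiffAt_modeCov y)).sqrt
    (modeCov_posDef y h.posDef.self_of_nhds).det_pos.ne'
  unfold approxDensity
  refine ((contDiffAt_const.mul hdet).mul hmode.exp).mul (contDiffAt_const.add
    (ContDiffAt.sum fun i _ => contDiffAt_const.mul (ContDiffAt.sum fun I _ =>
      ContDiffAt.sum fun t _ => ?_)))
  have hg : ContDiffAt ℝ 2 (fun θ => M.measurementDensity θ y (M.adaptedNode θ y I t)) θ₀ :=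
    contDiffAt_measurementDensity (τ := id) y h contDiffAt_id (h.contDiffAt_adaptedNode y I t)
  have hh : ContDiffAt ℝ 2 (fun θ => M.latentDensity θ (M.adaptedNode θ y I t)) θ₀ :=
    contDiffAt_latentDensity (τ := id) h contDiffAt_id (h.contDiffAt_adaptedNode y I t)
  exact (((hmode.neg.exp.mul contDiffAt_const).mul hg).mul hh).mul contDiffAt_const

end RegularAt

end DRM.GLLVM

theorem proposition2 {d p q s m : ℕ} (hs : s < q) (hm : 0 < m)
    -- the model, parametrized by `Θ ⊆ ℝ^d`, in a twice continuously differentiable way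
    (M : DRM.GLLVM d p q) (Θ : Set (EuclideanSpace ℝ (Fin d)))
    (hintercept : ∀ j, ContDiffOn ℝ 2 (fun θ => M.intercept θ j) (interior Θ))
    (hloading : ∀ k j, ContDiffOn ℝ 2 (fun θ => M.loading θ k j) (interior Θ))
    (hlatentCov : ∀ k k', ContDiffOn ℝ 2 (fun θ => M.latentCov θ k k') (interior Θ))
    (hposDef : ∀ θ ∈ Θ, (M.latentCov θ).PosDef)
    -- the DRM log-likelihood is defined on `Θ`
    (hpos : ∀ θ ∈ Θ, ∀ y, 0 < M.approxDensity s m θ y)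
    -- a random sample of response patterns
    {Ω : Type*} [MeasurableSpace Ω] (μ : Measure Ω) [IsProbabilityMeasure μ]
    (Y : ℕ → Ω → Fin p → Bool) (hindep : iIndepFun Y μ)
    (hident : ∀ l, IdentDistrib (Y l) (Y 0) μ μ)
    -- the value `θ₀` targeted by the M-estimator, interior to `Θ`
    (θ₀ : EuclideanSpace ℝ (Fin d)) (hinterior : θ₀ ∈ interior Θ)
    (htarget : ∀ ε > 0, ∃ δ > 0, ∀ θ ∈ Θ, ε ≤ dist θ θ₀ →
      M.expectedLogLik s m μ (Y 0) θ + δ ≤ M.expectedLogLik s m μ (Y 0) θ₀)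
    (hH : IsUnit (M.matH s m μ (Y 0) θ₀).det)
    -- the DRM estimator maximizes the DRM log-likelihood over `Θ`, with probability tending to 1
    (θhat : ℕ → Ω → EuclideanSpace ℝ (Fin d)) (hmeas : ∀ n, AEMeasurable (θhat n) μ)
    (hmax : Tendsto (fun n => μ {ω | ¬ (θhat n ω ∈ Θ ∧ ∀ θ ∈ Θ,
      M.sampleLogLik s m (fun l => Y l ω) n θ ≤
        M.sampleLogLik s m (fun l => Y l ω) n (θhat n ω))}) atTop (𝓝 0)) :
    TendstoInDistribution (fun (n : ℕ) ω => √(n : ℝ) • (θhat n ω - θ₀)) atTop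
      (id : EuclideanSpace ℝ (Fin d) → EuclideanSpace ℝ (Fin d)) (fun _ => μ)
      (multivariateGaussian 0 ((M.matH s m μ (Y 0) θ₀)⁻¹ * M.matU s m μ (Y 0) θ₀ *
        ((M.matH s m μ (Y 0) θ₀)⁻¹).transpose)) := by
  have hnhds : interior Θ ∈ 𝓝 θ₀ := isOpen_interior.mem_nhds hinterior
  have hΘ : Θ ∈ 𝓝 θ₀ := mem_interior_iff_mem_nhds.1 hinterior
  have hreg : M.RegularAt θ₀ :=
    ⟨fun j => (hintercept j).contDiffAt hnhds, fun k j => (hloading k j).contDiffAt hnhds,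
      fun k l => (hlatentCov k l).contDiffAt hnhds,
      by filter_upwards [hΘ] with θ hθ using hposDef θ hθ⟩
  have hbdd : ∀ y, BddAbove (M.approxLogLik s m y '' Θ) := fun y => by
    obtain ⟨K, hK⟩ := M.exists_approxDensity_le s m y
    refine ⟨Real.log K, ?_⟩
    rintro _ ⟨θ, hθ, rfl⟩
    exact Real.log_le_log (hpos θ hθ y) (hK θ (hposDef θ hθ))
  have hsmooth : ∀ y, ContDiffAt ℝ 2 (M.approxLogLik s m y) θ₀ := fun y =>
    (hreg.contDiffAt_approxDensity y s m).log (hpos θ₀ (mem_of_mem_nhds hΘ) y).ne'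
  exact tendstoInDistribution_mEstimator hΘ hbdd hsmooth hindep hident htarget rfl rfl hH hmeas hmax
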